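/- **Setting.** Let $\mathcal M=\{1,\dots,m\}$, $1\le k\le m$, and let $\mathcal A_k$ be the set of $k$-element subsets of $\mathcal M$. For $i\in\mathcal M$ let $\mathcal X_i$ be a finite alphabet and $\mathcal Y_i$ a nonempty finite reproduction alphabet; write $\mathcal X_A=\prod_{i\in A}\mathcal X_i$ and similarly $\mathcal Y_A$. Let $\Theta$ be a finite nonempty set and, for each $\tau\in\Theta$, let $P_{X_{\mathcal M}|\theta=\tau}$ be a pmf of full support on $\mathcal X_{\mathcal M}$. The sources $X_{\mathcal M1},X_{\mathcal M2},\dots$ are i.i.d. with pmf $P_{X_{\mathcal M}|\theta=\tau}$ given $\theta=\tau$. Fix a nonempty recovery set $B\subseteq\mathcal M$ and a distortion measure $d:\mathcal X_B\times\mathcal Y_B\to[0,\infty)$. In the Bayesian setting $\theta$ is a random variable with a known pmf $\mu_\theta$ of full support; in the nonBayesian setting $\theta$ is an unknown constant. Logarithms are to base $2$. **Codes.** An $n$-length code with $k$-independent random sampler ($k$-IRS) consists of $\mathcal A_k$-valued random variables $S_1,\dots,S_n$, independent of each other and of $(\theta, X^n_{\mathcal M})$, with arbitrary pmfs $P_{S_t}$;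 an encoder $f$ mapping $(S^n,X_S^n)$, $X_S^n=(X_{S_1 1},\dots,X_{S_n n})$, into $\{1,\dots,J\}$; and a decoder $\varphi:\mathcal A_k^n\times\{1,\dots,J\}\to\mathcal Y_B^n$. Its rate is $\frac1n\log J$, and its distortion under $\tau$ is $e(\tau)=\mathbb E\big[\frac1n\sum_{t=1}^n d\big(X_{Bt},(\varphi(S^n,f(S^n,X_S^n)))_t\big)\,\big|\,\theta=\tau\big]$. It meets level $\Delta$ if $\sum_\tau\mu_\theta(\tau)e(\tau)\le\Delta$ (Bayesian), respectively $\max_\tau e(\tau)\le\Delta$ (nonBayesian). A number $R\ge0$ is achievable at level $\Delta$ if for every $\epsilon>0$ and all sufficiently large $n$ there is an $n$-length code of rate less than $R+\epsilon$ that meets level $\Delta+\epsilon$. The universal sampling rate distortion function (USRDf) $R_\imath(\Delta)$ is the infimum of the achievable $R$. **Single-letter quantities.** Let $\Theta_2$ be the partition of $\Theta$ into atoms, two parameters lying in the same atom iff $P_{X_A|\theta=\tau}$ agrees for them for every $A\in\mathcal A_k$. For $\tau_2\in\Theta_2$ let $\Lambda(\tau_2)\subseteq\Theta$ be the atom, $\theta_2$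 the atom containing $\theta$, and $P_{X_A|\theta_2=\tau_2}$ ($A\in\mathcal A_k$) the common marginal. In the Bayesian setting put $d_{\tau_2}(x_A,y_B)=\mathbb E[d(X_B,y_B)\,|\,X_A=x_A,\theta_2=\tau_2]$. For a pmf $P_S$ on $\mathcal A_k$, with $S$ independent of $(\theta,X_{\mathcal M})$, define $$\rho_\imath^{\mathcal B}(\delta,P_S,\tau_2)=\min I(X_S\wedge Y_B\,|\,S,\theta_2=\tau_2),$$ the minimum being over conditional pmfs $P_{Y_B|SX_S,\theta_2=\tau_2}$ with $\sum_{A}P_S(A)\,\mathbb E[d_{\tau_2}(X_A,Y_B)\,|\,S=A,\theta_2=\tau_2]\le\delta$; and define $\rho_\imath^{n\mathcal B}(\delta,P_S,\tau_2)$ by the same formula with the constraint replaced by $\sum_{A}P_S(A)\,\mathbb E[d(X_B,Y_B)\,|\,S=A,\theta=\tau]\le\delta$ for every $\tau\in\Lambda(\tau_2)$. The minima exist whenever the constraint can be met; otherwise the value is $+\infty$. **Theorem 2.** (i) The Bayesian USRDf for a $k$-IRS is finite and equals $$R_\imath(\Delta)=\min_{\substack{P_S,\ \{\Delta_{\tau_2},\,\tau_2\in\Theta_2\}\\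 \mathbb E[\Delta_{\theta_2}]\le\Delta}}\ \max_{\tau_2\in\Theta_2}\ \rho_\imath^{\mathcal B}(\Delta_{\tau_2},P_S,\tau_2),\qquad \Delta_{\min}\le\Delta\le\Delta_{\max},$$ where $$\Delta_{\min}=\min_{A\in\mathcal A_k}\mathbb E\Big[\mathbb E\big[\min_{y_B}d_{\theta_2}(X_A,y_B)\,\big|\,\theta_2\big]\Big],\qquad \Delta_{\max}=\min_{A\in\mathcal A_k}\mathbb E\Big[\min_{y_B}\mathbb E\big[d_{\theta_2}(X_A,y_B)\,\big|\,\theta_2\big]\Big].$$ (ii) The nonBayesian USRDf for a $k$-IRS is finite and equals $$R_\imath(\Delta)=\min_{P_S}\ \max_{\tau_2\in\Theta_2}\ \rho_\imath^{n\mathcal B}(\Delta,P_S,\tau_2),\qquad \Delta_{\min}\le\Delta\le\Delta_{\max},$$ where $$\Delta_{\min}=\min_{P_S}\ \max_{\tau_2\in\Theta_2}\ \sum_{A\in\mathcal A_k}P_S(A)\ \min_{P_{Y_B|X_A}}\ \max_{\tau\in\Lambda(\tau_2)}\mathbb E[d(X_B,Y_B)\,|\,\theta=\tau],\qquad \Delta_{\max}=\max_{\tau_2\in\Theta_2}\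 \min_{y_B\in\mathcal Y_B}\ \max_{\tau\in\Lambda(\tau_2)}\mathbb E[d(X_B,y_B)\,|\,\theta=\tau],$$ and in $\Delta_{\min}$ the variable $Y_B$ is the output of $P_{Y_B|X_A}$ with input $X_A$, conditionally independent of $X_{\mathcal M}$ given $X_A$. -/

import Mathlib

namespace UniversalSampling

noncomputable section

/-- The `k`-element subsets of the index set of the `m` sources. -/
abbrev SampleSet (m k : ℕ) : Type := {A : Finset (Fin m) // A.card = k}

/-- The product alphabet `×_{i ∈ A} Z i`. -/
abbrev SubAlph {m : ℕ} (Z : Fin m → Type*) (A : Finset (Fin m)) := (i : A) → Z i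

/-- The components `x_A` of `x`. -/
def proj {m : ℕ} {Z : Fin m → Type*} (A : Finset (Fin m)) (x : ∀ i, Z i) : SubAlph Z A :=
  fun i => x i

section Source

variable {m : ℕ} {X Y : Fin m → Type*} [∀ i, Fintype (X i)] [∀ i, Fintype (Y i)]
variable {Θ : Type*} [Fintype Θ] {B : Finset (Fin m)}

open scoped Classical in
/-- The marginal pmf `P_{X_A}` of a pmf `p` of `X_M`. -/
def marginal (p : (∀ i, X i) → ℝ) (A : Finset (Fin m)) (a : SubAlph X A) : ℝ :=
  ∑ x, if proj A x = a then p x else 0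

/-- Two parameters are equivalent when all their `k`-marginals coincide. -/
def ambiguity (k : ℕ) (P : Θ → (∀ i, X i) → ℝ) : Setoid Θ where
  r τ τ' := ∀ A : SampleSet m k, marginal (P τ) A.1 = marginal (P τ') A.1
  iseqv := ⟨fun _ _ => rfl, fun h A => (h A).symm, fun h h' A => (h A).trans (h' A)⟩

/-- The partition `Θ₂`: its elements are the ambiguity atoms. -/
abbrev Atom (k : ℕ) (P : Θ → (∀ i, X i) → ℝ) := Quotient (ambiguity k P)

instance (k : ℕ) (P : Θ → (∀ i, X i) → ℝ) : Fintype (Atom k P) :=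
  Fintype.ofFinite _

open scoped Classical in
/-- `Λ(τ₂)`: the parameters in the atom `τ₂`. -/
def atomSet (k : ℕ) (P : Θ → (∀ i, X i) → ℝ) (τ₂ : Atom k P) : Finset Θ :=
  Finset.univ.filter fun τ => Quotient.mk (ambiguity k P) τ = τ₂

/-- The pmf of `θ₂` induced by the pmf `μ` of `θ`. -/
def atomPmf (k : ℕ) (P : Θ → (∀ i, X i) → ℝ) (μ : Θ → ℝ) (τ₂ : Atom k P) : ℝ :=
  ∑ τ ∈ atomSet k P τ₂, μ τ

/-- `P_{X_A | θ₂ = τ₂}`: the `A`-marginal that all the parameters in the atom `τ₂` share. -/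
def atomMarginal (k : ℕ) (P : Θ → (∀ i, X i) → ℝ) (A : SampleSet m k) (τ₂ : Atom k P) :
    SubAlph X A.1 → ℝ :=
  Quotient.lift (s := ambiguity k P) (fun τ => marginal (P τ) A.1) (fun _ _ h => h A) τ₂

open scoped Classical in
/-- `d_{τ₂}(a, y) = E[d(X_B, y) | X_A = a, θ₂ = τ₂]`. -/
def atomDist (k : ℕ) (P : Θ → (∀ i, X i) → ℝ) (μ : Θ → ℝ) (d : SubAlph X B → SubAlph Y B → ℝ)
    (A : SampleSet m k) (τ₂ : Atom k P) (a : SubAlph X A.1) (y : SubAlph Y B) : ℝ :=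
  (∑ τ ∈ atomSet k P τ₂, μ τ * ∑ x, if proj A.1 x = a then P τ x * d (proj B x) y else 0) /
    ∑ τ ∈ atomSet k P τ₂, μ τ * marginal (P τ) A.1 a

/-! Block codes with a `k`-independent random sampler. -/

/-- An `n`-length block code: the sampling sets `S_1, …, S_n` are independent of the sources and of
one another, `S_t` having pmf `sampler t`; the encoder sees `(S^n, X_S^n)`, and the decoder sees
`S^n` and the encoder output. -/
structure IRSCode {m : ℕ} (k : ℕ) (X Y : Fin m → Type*) (B : Finset (Fin m)) (n : ℕ) where
  sampler : Fin n → SampleSet m k → ℝ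
  sampler_mem : ∀ t, sampler t ∈ stdSimplex ℝ (SampleSet m k)
  J : ℕ
  enc : (Fin n → (A : SampleSet m k) × SubAlph X A.1) → Fin J
  dec : (Fin n → SampleSet m k) → Fin J → Fin n → SubAlph Y B

/-- The rate `(1/n) log₂ J`. -/
def IRSCode.rate {k n : ℕ} (c : IRSCode k X Y B n) : ℝ :=
  (1 / (n : ℝ)) * Real.logb 2 c.J

/-- The decoder output when the sampling sets are `s` and the source sequence is `x`. -/
def IRSCode.output {k n : ℕ} (c : IRSCode k X Y B n) (s : Fin n → SampleSet m k)
    (x : Fin n → ∀ i, X i) : Fin n → SubAlph Y B :=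
  c.dec s (c.enc fun t => ⟨s t, proj (s t).1 (x t)⟩)

/-- `E[d(X_B^n, φ(S^n, f(S^n, X_S^n)))]` when `X_{M1}, …, X_{Mn}` are i.i.d. with pmf `p`. -/
def IRSCode.distortion {k n : ℕ} (c : IRSCode k X Y B n) (d : SubAlph X B → SubAlph Y B → ℝ)
    (p : (∀ i, X i) → ℝ) : ℝ :=
  ∑ x : Fin n → ∀ i, X i, ∑ s : Fin n → SampleSet m k,
    (∏ t, p (x t)) * (∏ t, c.sampler t (s t)) *
      ((1 / (n : ℝ)) * ∑ t, d (proj B (x t)) (c.output s x t))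

/-- `R` is achievable at level `Δ`, where `crit` turns the family of the expected distortions under
the various `τ` into the number that has to meet the distortion level. -/
def Achievable (k : ℕ) (P : Θ → (∀ i, X i) → ℝ) (d : SubAlph X B → SubAlph Y B → ℝ)
    (crit : (Θ → ℝ) → ℝ) (Δ R : ℝ) : Prop :=
  0 ≤ R ∧ ∀ ε > 0, ∀ᶠ n : ℕ in Filter.atTop, ∃ c : IRSCode k X Y B n,
    c.rate < R + ε ∧ crit (fun τ => c.distortion d (P τ)) ≤ Δ + ε

/-- The Bayesian USRDf for a `k`-IRS: expected distortion criterion. -/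
def usrdfBayes (k : ℕ) (P : Θ → (∀ i, X i) → ℝ) (μ : Θ → ℝ) (d : SubAlph X B → SubAlph Y B → ℝ)
    (Δ : ℝ) : EReal :=
  ⨅ R ∈ {R : ℝ | Achievable k P d (fun e => ∑ τ, μ τ * e τ) Δ R}, (R : EReal)

/-- The nonBayesian USRDf for a `k`-IRS: peak distortion criterion. -/
def usrdfNonBayes (k : ℕ) (P : Θ → (∀ i, X i) → ℝ) (d : SubAlph X B → SubAlph Y B → ℝ)
    (Δ : ℝ) : EReal :=
  ⨅ R ∈ {R : ℝ | Achievable k P d (fun e => ⨆ τ, e τ) Δ R}, (R : EReal)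

/-! The single-letter quantities. -/

/-- The mutual information, in bits, between an input with pmf `p` and the output of the
channel `W`. -/
def mutualInfo {α β : Type*} [Fintype α] [Fintype β] (p : α → ℝ) (W : α → β → ℝ) : ℝ :=
  ∑ a, ∑ b, p a * W a b * Real.logb 2 (W a b / ∑ a', p a' * W a' b)

/-- The conditional pmfs `P_{Y_B | X_A}`. -/
abbrev Channel (X Y : Fin m → Type*) [∀ i, Fintype (Y i)] (B A : Finset (Fin m)) :=
  {V : SubAlph X A → SubAlph Y B → ℝ // ∀ a, V a ∈ stdSimplex ℝ (SubAlph Y B)}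

/-- The conditional pmfs `P_{Y_B | S X_S, θ₂ = τ₂}` for one fixed `τ₂`. -/
abbrev SampleChannel (k : ℕ) (X Y : Fin m → Type*) [∀ i, Fintype (Y i)] (B : Finset (Fin m)) :=
  (A : SampleSet m k) → Channel X Y B A.1

/-- `I(X_S ∧ Y_B | S, θ₂ = τ₂)`, where `S` has pmf `PS` and is independent of `(θ, X_M)`. -/
def condInfo (k : ℕ) (P : Θ → (∀ i, X i) → ℝ) (PS : SampleSet m k → ℝ) (τ₂ : Atom k P)
    (W : SampleChannel k X Y B) : ℝ :=
  ∑ A, PS A * mutualInfo (atomMarginal k P A τ₂) (W A).1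

/-- `E[d(X_B, Y_B)]` when `X_M` has pmf `p` and `Y_B` is the output of `V` with input `X_A`. -/
def channelDist (p : (∀ i, X i) → ℝ) (d : SubAlph X B → SubAlph Y B → ℝ) (A : Finset (Fin m))
    (V : Channel X Y B A) : ℝ :=
  ∑ x, p x * ∑ y, V.1 (proj A x) y * d (proj B x) y

/-- The Bayesian constraint set, described by the conditional pmfs of `Y_B` that determine its
members given `θ₂ = τ₂`. -/
def kappaBayes (k : ℕ) (P : Θ → (∀ i, X i) → ℝ) (μ : Θ → ℝ) (d : SubAlph X B → SubAlph Y B → ℝ)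
    (δ : ℝ) (PS : SampleSet m k → ℝ) (τ₂ : Atom k P) : Set (SampleChannel k X Y B) :=
  {W | ∑ A, PS A * ∑ a, atomMarginal k P A τ₂ a *
      ∑ y, (W A).1 a y * atomDist k P μ d A τ₂ a y ≤ δ}

/-- The nonBayesian constraint set. -/
def kappaNonBayes (k : ℕ) (P : Θ → (∀ i, X i) → ℝ) (d : SubAlph X B → SubAlph Y B → ℝ)
    (δ : ℝ) (PS : SampleSet m k → ℝ) (τ₂ : Atom k P) : Set (SampleChannel k X Y B) :=
  {W | ∀ τ ∈ atomSet k P τ₂, ∑ A, PS A * channelDist (P τ) d A.1 (W A) ≤ δ}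

/-- The minimum of `I(X_S ∧ Y_B | S, θ₂ = τ₂)` over the Bayesian constraint set
(`⊤` if the set is empty). -/
def rhoBayes (k : ℕ) (P : Θ → (∀ i, X i) → ℝ) (μ : Θ → ℝ) (d : SubAlph X B → SubAlph Y B → ℝ)
    (δ : ℝ) (PS : SampleSet m k → ℝ) (τ₂ : Atom k P) : EReal :=
  ⨅ W ∈ kappaBayes k P μ d δ PS τ₂, (condInfo k P PS τ₂ W : EReal)

/-- The minimum of `I(X_S ∧ Y_B | S, θ₂ = τ₂)` over the nonBayesian constraint set
(`⊤` if the set is empty). -/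
def rhoNonBayes (k : ℕ) (P : Θ → (∀ i, X i) → ℝ) (d : SubAlph X B → SubAlph Y B → ℝ)
    (δ : ℝ) (PS : SampleSet m k → ℝ) (τ₂ : Atom k P) : EReal :=
  ⨅ W ∈ kappaNonBayes k P d δ PS τ₂, (condInfo k P PS τ₂ W : EReal)

/-! The end points of the ranges of distortion levels. -/

/-- `min_A E[E[min_y d_{θ₂}(X_A, y) | θ₂]]`. -/
def deltaMinBayes (k : ℕ) (P : Θ → (∀ i, X i) → ℝ) (μ : Θ → ℝ)
    (d : SubAlph X B → SubAlph Y B → ℝ) : ℝ :=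
  ⨅ A : SampleSet m k, ∑ τ₂, atomPmf k P μ τ₂ *
    ∑ a, atomMarginal k P A τ₂ a * ⨅ y, atomDist k P μ d A τ₂ a y

/-- `min_A E[min_y E[d_{θ₂}(X_A, y) | θ₂]]`. -/
def deltaMaxBayes (k : ℕ) (P : Θ → (∀ i, X i) → ℝ) (μ : Θ → ℝ)
    (d : SubAlph X B → SubAlph Y B → ℝ) : ℝ :=
  ⨅ A : SampleSet m k, ∑ τ₂, atomPmf k P μ τ₂ *
    ⨅ y, ∑ a, atomMarginal k P A τ₂ a * atomDist k P μ d A τ₂ a y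

/-- `min_{P_S} max_{τ₂} ∑_A P_S(A) min_{P_{Y_B|X_A}} max_{τ ∈ Λ(τ₂)} E[d(X_B, Y_B) | S = A, θ = τ]`. -/
def deltaMinNonBayes (k : ℕ) (P : Θ → (∀ i, X i) → ℝ) (d : SubAlph X B → SubAlph Y B → ℝ) : ℝ :=
  ⨅ PS : stdSimplex ℝ (SampleSet m k), ⨆ τ₂ : Atom k P, ∑ A : SampleSet m k, PS.1 A *
    ⨅ V : Channel X Y B A.1, ⨆ τ : atomSet k P τ₂, channelDist (P τ) d A.1 V

/-- `max_{τ₂} min_y max_{τ ∈ Λ(τ₂)} E[d(X_B, y) | θ = τ]`. -/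
def deltaMaxNonBayes (k : ℕ) (P : Θ → (∀ i, X i) → ℝ) (d : SubAlph X B → SubAlph Y B → ℝ) : ℝ :=
  ⨆ τ₂ : Atom k P, ⨅ y : SubAlph Y B, ⨆ τ : atomSet k P τ₂, ∑ x, P τ x * d (proj B x) y

end Source

end

end UniversalSampling

namespace UniversalSampling

open Finset Filter Topology

/-! ### Sums over blocks of product weights -/

section Blocks

variable {ι α Z S Y : Type*} [Fintype ι] [DecidableEq ι]

/-! The sampling sets are known at both ends, so they act as side information. The effective source
letter is `z = (A, x_A)`, with side information `A`, and the distortion is averaged over the unseen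
components (`condDist`, `distortion_eq`). The law of `z` depends on the parameter only through its
atom. A candidate solution is therefore a `Scheme`: one sampling pmf, which cannot depend on the
unknown atom, and one test channel per atom.

Achievability (`eventually_exists_code`). If the sampling pmf has full support, distinct atoms give
distinct laws of `z`, and a maximum likelihood test on the block identifies the atom with vanishing
error (`eventually_exists_test`). The encoder sends the estimate, at a rate cost tending to zero,
followed by the index of a word from a codebook built for that atom. Such codebooks come from random
coding (`exists_codebook`) with Chernoff bounds (`eventually_exists_cover`). Since each word must
meet the distortion averages for all parameters at once, one code serves every parameter. General
sampling pmfs are reached by perturbation.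

Converse (`exists_channel_of_code`). Averaging over time the joint law of source letter and
reproduction letter gives a test channel with exactly the distortions of the code. Its mutual
information is the normalized expectation of a log-likelihood ratio whose expected ratio is at most
the number of messages `J`; the inequality `log x ≤ x - 1` then bounds it by the rate. The reference
output law is that of the averaged channel itself, so no convexity argument is needed.

Schemes form a compact space on which information and distortion are continuous. Hence the errors
`ε` can be sent to zero and the optimum is attained. `exists_scheme_usrdf_eq` states this for any
continuous monotone criterion that grows by at most `ε` when all distortions grow by `ε`; the
average and the maximum are the two instances, and unfolding them atom by atom gives the two
formulas. -/

open scoped Classical in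
theorem sum_piFinset_prod_mul_apply (A : ι → Finset α) (w : ι → α → ℝ) (h : α → ℝ) (t : ι) :
    ∑ a ∈ Fintype.piFinset A, (∏ i, w i (a i)) * h (a t) =
      ∏ i, ∑ b ∈ A i, w i b * if i = t then h b else 1 := by
  -- `h (a t)` is a product over `i` with all factors but one equal to 1, so the sum over the box
  -- factorizes.
  rw [Finset.prod_univ_sum]
  refine Finset.sum_congr rfl fun a _ => ?_
  rw [Finset.prod_mul_distrib]
  simp

open scoped Classical in
theorem sum_eq_sum_fiber [Fintype Z] [Fintype S] (π : Z → S) (F : (ι → Z) → ℝ) :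
    ∑ z, F z = ∑ s : ι → S, ∑ z ∈ Fintype.piFinset fun t => univ.filter fun z => π z = s t, F z := by
  rw [← Finset.sum_fiberwise univ (fun z : ι → Z => π ∘ z) F]
  refine Finset.sum_congr rfl fun s _ => Finset.sum_congr ?_ fun _ _ => rfl
  ext z
  simp [Fintype.mem_piFinset, funext_iff]

theorem sum_prod_mul_apply [Fintype α] (w : ι → α → ℝ) (hw : ∀ i, ∑ a, w i a = 1) (h : α → ℝ)
    (t : ι) : ∑ a : ι → α, (∏ i, w i (a i)) * h (a t) = ∑ b, w t b * h b := by
  classical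
  have := sum_piFinset_prod_mul_apply (fun _ => univ) w h t
  rw [Fintype.piFinset_univ] at this
  rw [this, Finset.prod_eq_single t]
  · simp
  · intro i _ hi; simp [hi, hw]
  · simp

open scoped Classical in
/-- Change of variables for a block that is mapped letter by letter, the mapped block being all
that `G` depends on. -/
theorem sum_block_comp [Fintype α] [Fintype Z] {β : Type*} (ζ : α → Z) (w : ι → α → ℝ)
    (q : ι → Z → ℝ)
    (h : α → Y → ℝ) (D : Z → Y → ℝ)
    (hq : ∀ i z, ∑ a ∈ univ.filter (fun a => ζ a = z), w i a = q i z)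
    (hD : ∀ i z y, ∑ a ∈ univ.filter (fun a => ζ a = z), w i a * h a y = q i z * D z y)
    (f : (ι → Z) → β) (g : β → Y) (t : ι) :
    ∑ a : ι → α, (∏ i, w i (a i)) * h (a t) (g (f fun i => ζ (a i))) =
      ∑ z, (∏ i, q i (z i)) * D (z t) (g (f z)) := by
  rw [sum_eq_sum_fiber ζ]
  refine Finset.sum_congr rfl fun z _ => ?_
  -- On a fibre the mapped block is constant, so the second argument of `h` is frozen and the sum
  -- factorizes over coordinates.
  have h1 : ∀ a ∈ Fintype.piFinset (fun t => univ.filter fun a => ζ a = z t),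
      (∏ i, w i (a i)) * h (a t) (g (f fun i => ζ (a i))) =
      (∏ i, w i (a i)) * (fun b => h b (g (f z))) (a t) := by
    intro a ha
    have : (fun i => ζ (a i)) = z := by
      funext i
      have := Fintype.mem_piFinset.1 ha i
      simpa using this
    rw [this]
  rw [Finset.sum_congr rfl h1,
    sum_piFinset_prod_mul_apply _ w (fun b => h b (g (f z))) t]
  have h2 : ∀ i, (∑ b ∈ univ.filter (fun a => ζ a = z i),
      w i b * if i = t then h b (g (f z)) else 1) =
      q i (z i) * if i = t then D (z t) (g (f z)) else 1 := by
    intro i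
    by_cases hi : i = t
    · subst hi; simp [hD]
    · simp [hi, hq]
  simp only [h2]
  rw [Finset.prod_mul_distrib]
  simp

theorem sum_prod_eq_one [Fintype α] {w : ι → α → ℝ} (hw : ∀ i, ∑ a, w i a = 1) :
    ∑ a : ι → α, ∏ i, w i (a i) = 1 := by
  rw [← Fintype.prod_sum]
  simp [hw]

end Blocks

/-! ### Large deviations -/

section Chernoff

variable {Ω : Type*} [Fintype Ω]

-- Exponential Markov inequality. The moment generating function of `f - c` equals 1 at 0 and has
-- negative derivative there, so it drops below 1 at some `l > 0`; that value is `ρ`.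
open scoped Classical in
theorem exists_chernoff {Q : Ω → ℝ} (hQ : ∀ ω, 0 ≤ Q ω) (hQ1 : ∑ ω, Q ω = 1) (f : Ω → ℝ) {c : ℝ}
    (hc : ∑ ω, Q ω * f ω < c) :
    ∃ ρ : ℝ, 0 ≤ ρ ∧ ρ < 1 ∧ ∀ n : ℕ,
      ∑ ω : Fin n → Ω, (∏ t, Q (ω t)) * (if ∑ t, f (ω t) ≤ n * c then 0 else 1) ≤ ρ ^ n := by
  let φ : ℝ → ℝ := fun l => ∑ ω, Q ω * Real.exp (l * (f ω - c))
  have hφ0 : φ 0 = 1 := by simp [φ, hQ1]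
  have hφ : HasDerivAt φ (∑ ω, Q ω * (f ω - c)) 0 := by
    have : ∀ ω ∈ (univ : Finset Ω), HasDerivAt (fun l : ℝ => Q ω * Real.exp (l * (f ω - c)))
        (Q ω * (f ω - c)) 0 := by
      intro ω _
      have h := (((hasDerivAt_id (0 : ℝ)).mul_const (f ω - c)).exp).const_mul (Q ω)
      simpa using h
    exact HasDerivAt.fun_sum this
  have hneg : ∑ ω, Q ω * (f ω - c) < 0 := by
    simp only [mul_sub, Finset.sum_sub_distrib, ← Finset.sum_mul, hQ1]
    linarith
  obtain ⟨l, hl, hl1⟩ : ∃ l > 0, φ l < 1 := by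
    have h1 := hφ.hasDerivWithinAt (s := Set.Ioi 0)
    rw [hasDerivWithinAt_iff_tendsto_slope' (by simp)] at h1
    have h2 := (h1.eventually (gt_mem_nhds hneg)).and self_mem_nhdsWithin
    obtain ⟨l, hl, hl0⟩ := h2.exists
    refine ⟨l, hl0, ?_⟩
    have hl0 : 0 < l := hl0
    rw [slope_def_field, hφ0, sub_zero, div_lt_iff₀ hl0] at hl
    linarith
  refine ⟨φ l, Finset.sum_nonneg fun ω _ => mul_nonneg (hQ ω) (Real.exp_pos _).le, hl1,
    fun n => ?_⟩
  rw [Fintype.sum_pow]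
  refine Finset.sum_le_sum fun ω _ => ?_
  rw [Finset.prod_mul_distrib, ← Real.exp_sum]
  refine mul_le_mul_of_nonneg_left ?_ (Finset.prod_nonneg fun t _ => hQ _)
  split_ifs with h
  · exact (Real.exp_pos _).le
  · rw [← Finset.mul_sum, Real.one_le_exp_iff]
    refine mul_nonneg hl.le ?_
    simp only [Finset.sum_sub_distrib, Finset.sum_const, card_univ, Fintype.card_fin, nsmul_eq_mul]
    linarith

/-- The Bhattacharyya coefficient of two distinct pmfs is less than one. -/
theorem sum_sqrt_mul_lt_one {p q : Ω → ℝ} (hp : ∀ ω, 0 ≤ p ω) (hq : ∀ ω, 0 ≤ q ω)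
    (hp1 : ∑ ω, p ω = 1) (hq1 : ∑ ω, q ω = 1) (hpq : p ≠ q) :
    ∑ ω, √(p ω) * √(q ω) < 1 := by
  -- The squared Hellinger distance, which is positive for distinct pmfs.
  have h : ∑ ω, (√(p ω) - √(q ω)) ^ 2 = 2 - 2 * ∑ ω, √(p ω) * √(q ω) := by
    have : ∀ ω, (√(p ω) - √(q ω)) ^ 2 = p ω + q ω - 2 * (√(p ω) * √(q ω)) := by
      intro ω
      have h1 := Real.sq_sqrt (hp ω)
      have h2 := Real.sq_sqrt (hq ω)
      linear_combination h1 + h2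
    simp only [this, Finset.sum_sub_distrib, Finset.sum_add_distrib, hp1, hq1, ← Finset.mul_sum]
    ring
  have hpos : 0 < ∑ ω, (√(p ω) - √(q ω)) ^ 2 := by
    obtain ⟨ω, hω⟩ := Function.ne_iff.1 hpq
    refine Finset.sum_pos' (fun _ _ => sq_nonneg _) ⟨ω, mem_univ _, ?_⟩
    exact sq_pos_of_ne_zero (sub_ne_zero.2 fun h => hω ((Real.sqrt_inj (hp ω) (hq ω)).1 h))
  linarith

open scoped Classical in
/-- Maximum likelihood tests distinguish finitely many distinct pmfs. -/
theorem eventually_exists_test {T : Type*} [Fintype T] [Nonempty T] {q : T → Ω → ℝ}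
    (hq : ∀ a ω, 0 ≤ q a ω) (hq1 : ∀ a, ∑ ω, q a ω = 1) (hinj : Function.Injective q)
    {δ : ℝ} (hδ : 0 < δ) :
    ∀ᶠ n : ℕ in atTop, ∃ est : (Fin n → Ω) → T, ∀ a,
      ∑ ω : Fin n → Ω, (∏ t, q a (ω t)) * (if est ω = a then 0 else 1) ≤ δ := by
  have key : ∀ a, Tendsto (fun n : ℕ => ∑ b ∈ univ.erase a,
      (∑ ω, √(q a ω) * √(q b ω)) ^ n) atTop (𝓝 0) := by
    intro a
    have : (0 : ℝ) = ∑ b ∈ univ.erase a, 0 := by simp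
    rw [this]
    refine tendsto_finsetSum _ fun b hb => ?_
    refine tendsto_pow_atTop_nhds_zero_of_lt_one
      (Finset.sum_nonneg fun ω _ => mul_nonneg (Real.sqrt_nonneg _) (Real.sqrt_nonneg _)) ?_
    exact sum_sqrt_mul_lt_one (hq a) (hq b) (hq1 a) (hq1 b)
      (fun h => (Finset.ne_of_mem_erase hb) (hinj h).symm)
  have hev : ∀ᶠ n : ℕ in atTop, ∀ a, ∑ b ∈ univ.erase a,
      (∑ ω, √(q a ω) * √(q b ω)) ^ n < δ :=
    eventually_all.2 fun a => (key a).eventually (gt_mem_nhds hδ)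
  filter_upwards [hev] with n hn
  choose est hest using fun ω : Fin n → Ω => Finite.exists_max fun a => ∏ t, q a (ω t)
  refine ⟨est, fun a => le_trans ?_ (hn a).le⟩
  simp only [Fintype.sum_pow]
  rw [Finset.sum_comm]
  refine Finset.sum_le_sum fun ω _ => ?_
  have hnn : ∀ b, 0 ≤ ∏ t, q b (ω t) := fun b => Finset.prod_nonneg fun t _ => hq b _
  have hterm : ∀ b, 0 ≤ ∏ t, (√(q a (ω t)) * √(q b (ω t))) := fun b =>
    Finset.prod_nonneg fun t _ => mul_nonneg (Real.sqrt_nonneg _) (Real.sqrt_nonneg _)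
  split_ifs with h
  · rw [mul_zero]
    exact Finset.sum_nonneg fun b _ => hterm b
  -- A wrong estimate is at least as likely as `a`, so the likelihood of `a` is at most the
  -- geometric mean of the two. That is one term of the union bound, and its sum over blocks is a
  -- power of the Bhattacharyya coefficient.
  · refine le_trans ?_ (Finset.single_le_sum (fun b _ => hterm b)
      (Finset.mem_erase.2 ⟨h, mem_univ (est ω)⟩))
    rw [Finset.prod_mul_distrib, ← Real.sqrt_prod _ fun t _ => hq a _,
      ← Real.sqrt_prod _ fun t _ => hq (est ω) _, mul_one]
    calc ∏ t, q a (ω t) = √(∏ t, q a (ω t)) * √(∏ t, q a (ω t)) :=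
          (Real.mul_self_sqrt (hnn a)).symm
      _ ≤ _ := mul_le_mul_of_nonneg_left (Real.sqrt_le_sqrt (hest ω a)) (Real.sqrt_nonneg _)

end Chernoff

/-! ### Random codebooks -/

section Codebook

open scoped Classical in
/-- One-shot covering by a random codebook. -/
theorem exists_codebook {X Y : Type*} [Fintype X] [Fintype Y] {p : X → ℝ} (hp : ∀ x, 0 ≤ p x)
    {V : X → Y → ℝ} (hV : ∀ x y, 0 ≤ V x y) (hV1 : ∀ x, ∑ y, V x y = 1)
    {R : Y → ℝ} (hR : ∀ y, 0 ≤ R y) (hR1 : ∑ y, R y = 1) (F : X → Y → Prop) {u : ℝ}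
    (hF : ∀ x y, p x ≠ 0 → F x y → u * V x y ≤ R y) (M : ℕ) :
    ∃ C : Fin M → Y, ∑ x, p x * (if ∃ j, F x (C j) then 0 else 1) ≤
      ∑ x, p x * (∑ y, V x y * if F x y then 0 else 1) + (∑ x, p x) * Real.exp (-(M * u)) := by
  set b := ∑ x, p x * (∑ y, V x y * if F x y then 0 else 1) + (∑ x, p x) * Real.exp (-(M * u))
    with hb
  -- The codewords are drawn independently with law `R`; the bound is proved on average over
  -- codebooks.
  have havg : ∑ C : Fin M → Y, (∏ j, R (C j)) * ∑ x, p x * (if ∃ j, F x (C j) then 0 else 1)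
      ≤ b := by
    have h1 : ∀ x, ∑ C : Fin M → Y, (∏ j, R (C j)) * (if ∃ j, F x (C j) then (0 : ℝ) else 1) =
        (∑ y, R y * if F x y then 0 else 1) ^ M := by
      intro x
      rw [Fintype.sum_pow]
      refine Finset.sum_congr rfl fun C _ => ?_
      rw [Finset.prod_mul_distrib]
      congr 1
      split_ifs with h
      · obtain ⟨j, hj⟩ := h
        exact (Finset.prod_eq_zero (mem_univ j) (by simp [hj])).symm
      · push Not at h
        simp [h]
    simp only [Finset.mul_sum, mul_left_comm]
    rw [Finset.sum_comm]
    simp only [← Finset.mul_sum, h1]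
    rw [hb, Finset.sum_mul, ← Finset.sum_add_distrib]
    refine Finset.sum_le_sum fun x _ => ?_
    rw [← mul_add]
    by_cases hx : p x = 0
    · simp [hx]
    refine mul_le_mul_of_nonneg_left ?_ (hp x)
    -- `v` is the success probability under the channel; by `hF` a single random codeword succeeds
    -- with probability at least `u * v`.
    set v := ∑ y, V x y * if F x y then 1 else 0 with hv
    have hv0 : 0 ≤ v := Finset.sum_nonneg fun y _ => mul_nonneg (hV x y) (by split_ifs <;> simp)
    have hbad : ∑ y, V x y * (if F x y then (0 : ℝ) else 1) = 1 - v := by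
      rw [eq_sub_iff_add_eq, hv, ← Finset.sum_add_distrib]
      refine Eq.trans (Finset.sum_congr rfl fun y _ => ?_) (hV1 x)
      split_ifs <;> simp
    have hv1 : v ≤ 1 := by
      have : 0 ≤ ∑ y, V x y * (if F x y then (0 : ℝ) else 1) :=
        Finset.sum_nonneg fun y _ => mul_nonneg (hV x y) (by split_ifs <;> simp)
      linarith
    have hRbad : ∑ y, R y * (if F x y then (0 : ℝ) else 1) ≤ 1 - u * v := by
      rw [le_sub_iff_add_le, hv, Finset.mul_sum, ← Finset.sum_add_distrib]
      refine (Finset.sum_le_sum fun y _ => ?_).trans_eq hR1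
      split_ifs with h
      · have := hF x y hx h
        simpa using this
      · simp
    have hRbad0 : 0 ≤ ∑ y, R y * (if F x y then (0 : ℝ) else 1) :=
      Finset.sum_nonneg fun y _ => mul_nonneg (hR y) (by split_ifs <;> simp)
    rw [hbad]
    calc (∑ y, R y * (if F x y then (0 : ℝ) else 1)) ^ M
        ≤ (Real.exp (-(u * v))) ^ M := by
          refine pow_le_pow_left₀ hRbad0 (hRbad.trans ?_) M
          have := Real.add_one_le_exp (-(u * v))
          linarith
      _ = Real.exp ((1 - v) * 0 + v * (-(M * u))) := by
          rw [← Real.exp_nat_mul]; congr 1; ring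
      -- Convexity of `exp` separates the failure of the channel from the failure of the codebook.
      _ ≤ (1 - v) * Real.exp 0 + v * Real.exp (-(M * u)) := by
          have := convexOn_exp.2 (Set.mem_univ (0 : ℝ)) (Set.mem_univ (-(M * u)))
            (sub_nonneg.2 hv1) hv0 (by ring)
          simpa [smul_eq_mul] using this
      _ ≤ 1 - v + Real.exp (-(M * u)) := by
          rw [Real.exp_zero, mul_one]
          have := mul_le_mul_of_nonneg_right hv1 (Real.exp_pos (-(M * u))).le
          linarith
  -- If every codebook exceeded the bound, so would the average.
  by_contra! hcon
  have hsum : ∑ C : Fin M → Y, ∏ j, R (C j) = 1 := sum_prod_eq_one fun _ => hR1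
  have hnn : ∀ C : Fin M → Y, 0 ≤ ∏ j, R (C j) := fun C => Finset.prod_nonneg fun j _ => hR _
  have : ∃ C ∈ (univ : Finset (Fin M → Y)), 0 < ∏ j, R (C j) := by
    by_contra! h0
    have := Finset.sum_nonpos h0
    linarith
  obtain ⟨C, -, hC⟩ := this
  have hlt : ∑ C : Fin M → Y, (∏ j, R (C j)) * b <
      ∑ C : Fin M → Y, (∏ j, R (C j)) * ∑ x, p x * (if ∃ j, F x (C j) then 0 else 1) :=
    Finset.sum_lt_sum (fun C _ => mul_le_mul_of_nonneg_left (hcon C).le (hnn C))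
      ⟨C, mem_univ _, mul_lt_mul_of_pos_left (hcon C) hC⟩
  rw [← Finset.sum_mul, hsum, one_mul] at hlt
  linarith

end Codebook

end UniversalSampling

namespace UniversalSampling

open Finset Filter Topology

/-! ### Codes for a source with side information

A source letter `z` comes with side information `π z`; its pmf is `σ (π z) * p z`. -/

noncomputable section

section Achievability

variable {Z S Y : Type*} [Fintype Z]

open scoped Classical in
/-- The conditional output pmf of the channel `W` given the side information. -/
def outputPmf (π : Z → S) (p : Z → ℝ) (W : Z → Y → ℝ) (s : S) (y : Y) : ℝ :=
  ∑ z ∈ univ.filter (fun z => π z = s), p z * W z y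

/-- The conditional mutual information given the side information, in bits. -/
def sideInfo [Fintype Y] (π : Z → S) (σ : S → ℝ) (p : Z → ℝ) (W : Z → Y → ℝ) : ℝ :=
  ∑ z, σ (π z) * p z * ∑ y, W z y * Real.logb 2 (W z y / outputPmf π p W (π z) y)

theorem outputPmf_nonneg {π : Z → S} {p : Z → ℝ} (hp : ∀ z, 0 < p z) {W : Z → Y → ℝ}
    (hW : ∀ z y, 0 ≤ W z y) (s : S) (y : Y) : 0 ≤ outputPmf π p W s y :=
  Finset.sum_nonneg fun z _ => mul_nonneg (hp z).le (hW z y)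

theorem outputPmf_pos {π : Z → S} {p : Z → ℝ} (hp : ∀ z, 0 < p z) {W : Z → Y → ℝ}
    (hW : ∀ z y, 0 ≤ W z y) {z : Z} {y : Y} (h : 0 < W z y) : 0 < outputPmf π p W (π z) y :=
  Finset.sum_pos' (fun z _ => mul_nonneg (hp z).le (hW z y))
    ⟨z, by simp, mul_pos (hp z) h⟩

open scoped Classical in
theorem sum_outputPmf [Fintype Y] {π : Z → S} {p : Z → ℝ}
    (hp1 : ∀ s, ∑ z ∈ univ.filter (fun z => π z = s), p z = 1) {W : Z → Y → ℝ}
    (hW1 : ∀ z, ∑ y, W z y = 1) (s : S) : ∑ y, outputPmf π p W s y = 1 := by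
  unfold outputPmf
  rw [Finset.sum_comm]
  simp only [← Finset.mul_sum, hW1, mul_one, hp1]

open scoped Classical in
theorem sum_source [Fintype S] {π : Z → S} {σ : S → ℝ} {p : Z → ℝ} (hσ1 : ∑ s, σ s = 1)
    (hp1 : ∀ s, ∑ z ∈ univ.filter (fun z => π z = s), p z = 1) :
    ∑ z, σ (π z) * p z = 1 := by
  rw [← Finset.sum_fiberwise univ π, ← hσ1]
  refine Finset.sum_congr rfl fun s _ => ?_
  rw [Finset.sum_congr rfl (g := fun z => σ s * p z), ← Finset.mul_sum, hp1, mul_one]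
  intro z hz
  rw [(Finset.mem_filter.1 hz).2]

/-- Change of measure: an information density of at most `n * γ` bounds the likelihood ratio by `2 ^
(n * γ)`. Blocks with a zero channel factor are treated apart, since there the logarithm carries no
information but the left side vanishes. -/
theorem mul_prod_le_prod_outputPmf {π : Z → S} {p : Z → ℝ} (hp : ∀ z, 0 < p z) {W : Z → Y → ℝ}
    (hW : ∀ z y, 0 ≤ W z y) {γ : ℝ} {n : ℕ} (z : Fin n → Z) (y : Fin n → Y)
    (h : ∑ t, Real.logb 2 (W (z t) (y t) / outputPmf π p W (π (z t)) (y t)) ≤ n * γ) :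
    (2 : ℝ) ^ (-(n * γ)) * ∏ t, W (z t) (y t) ≤ ∏ t, outputPmf π p W (π (z t)) (y t) := by
  by_cases hpos : ∀ t, 0 < W (z t) (y t)
  · have hr : ∀ t, 0 < outputPmf π p W (π (z t)) (y t) := fun t => outputPmf_pos hp hW (hpos t)
    have h1 : ∏ t, W (z t) (y t) / outputPmf π p W (π (z t)) (y t) ≤ (2 : ℝ) ^ (n * γ) := by
      rw [← Real.logb_le_iff_le_rpow one_lt_two
        (Finset.prod_pos fun t _ => div_pos (hpos t) (hr t)), Real.logb_prod]
      · exact h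
      · exact fun t _ => (div_pos (hpos t) (hr t)).ne'
    rw [Finset.prod_div_distrib, div_le_iff₀ (Finset.prod_pos fun t _ => hr t)] at h1
    rw [Real.rpow_neg two_pos.le, inv_mul_le_iff₀ (Real.rpow_pos_of_pos two_pos _)]
    exact h1
  · push Not at hpos
    obtain ⟨t, ht⟩ := hpos
    rw [Finset.prod_eq_zero (mem_univ t) (le_antisymm ht (hW _ _)), mul_zero]
    exact Finset.prod_nonneg fun t _ => outputPmf_nonneg hp hW _ _

open scoped Classical in
/-- The probability that one of finitely many empirical averages is too large vanishes. -/
theorem tendsto_sum_not_forall {Ω K : Type*} [Fintype Ω] [Fintype K] {Q : Ω → ℝ}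
    (hQ : ∀ ω, 0 ≤ Q ω) (hQ1 : ∑ ω, Q ω = 1) (f : K → Ω → ℝ) {c : K → ℝ}
    (hc : ∀ k, ∑ ω, Q ω * f k ω < c k) :
    Tendsto (fun n : ℕ => ∑ ω : Fin n → Ω, (∏ t, Q (ω t)) *
      (if ∀ k, ∑ t, f k (ω t) ≤ n * c k then (0 : ℝ) else 1)) atTop (𝓝 0) := by
  choose ρ hρ0 hρ1 hρ using fun k => exists_chernoff hQ hQ1 (f k) (hc k)
  have hlim : Tendsto (fun n : ℕ => ∑ k, ρ k ^ n) atTop (𝓝 0) := by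
    have : (0 : ℝ) = ∑ k : K, 0 := by simp
    rw [this]
    exact tendsto_finsetSum _ fun k _ =>
      tendsto_pow_atTop_nhds_zero_of_lt_one (hρ0 k) (hρ1 k)
  have hnn : ∀ (n : ℕ) (ω : Fin n → Ω), 0 ≤ ∏ t, Q (ω t) :=
    fun n ω => Finset.prod_nonneg fun t _ => hQ _
  refine squeeze_zero (fun n => Finset.sum_nonneg fun ω _ => mul_nonneg (hnn n ω)
    (by split_ifs <;> simp)) (fun n => ?_) hlim
  refine le_trans ?_ (Finset.sum_le_sum fun k _ => hρ k n)
  rw [Finset.sum_comm]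
  refine Finset.sum_le_sum fun ω _ => ?_
  rw [← Finset.mul_sum]
  refine mul_le_mul_of_nonneg_left ?_ (hnn n ω)
  have h0 : ∀ k ∈ (univ : Finset K),
      (0 : ℝ) ≤ if ∑ t, f k (ω t) ≤ n * c k then 0 else 1 := fun k _ => by split_ifs <;> simp
  split_ifs with h
  · exact Finset.sum_nonneg h0
  · push Not at h
    obtain ⟨k, hk⟩ := h
    refine le_trans ?_ (Finset.single_le_sum h0 (mem_univ k))
    rw [if_neg (not_le.2 hk)]

theorem sum_arrow_prod [Fintype Y] {n : ℕ} (F : (Fin n → Z × Y) → ℝ) :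
    ∑ ω, F ω = ∑ z : Fin n → Z, ∑ y : Fin n → Y, F fun t => (z t, y t) := by
  rw [← Fintype.sum_prod_type', ← (Equiv.arrowProdEquivProdArrow (Fin n) _ _).sum_comp]
  rfl

open scoped Classical in
/-- Covering: codebooks of rate above the mutual information contain, with high probability, a
codeword whose empirical averages with the source block are at most slightly above the
expectations. -/
theorem eventually_exists_cover [Fintype S] [Fintype Y] {π : Z → S} {σ : S → ℝ}
    (hσ : ∀ s, 0 ≤ σ s) (hσ1 : ∑ s, σ s = 1)
    {p : Z → ℝ} (hp : ∀ z, 0 < p z)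
    (hp1 : ∀ s, ∑ z ∈ univ.filter (fun z => π z = s), p z = 1)
    {W : Z → Y → ℝ} (hW : ∀ z y, 0 ≤ W z y) (hW1 : ∀ z, ∑ y, W z y = 1)
    {K : Type*} [Fintype K] (f : K → Z → Y → ℝ) {c : K → ℝ}
    (hc : ∀ k, ∑ z, σ (π z) * p z * ∑ y, W z y * f k z y < c k)
    {γ γ' : ℝ} (hγ : sideInfo π σ p W < γ) (hγ' : γ < γ') {δ : ℝ} (hδ : 0 < δ) :
    ∀ᶠ n : ℕ in atTop, ∀ M : ℕ, (2 : ℝ) ^ (n * γ') ≤ M →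
      ∃ dec : (Fin n → S) → Fin M → Fin n → Y,
        ∑ z : Fin n → Z, (∏ t, σ (π (z t)) * p (z t)) *
          (if ∃ j, ∀ k, ∑ t, f k (z t) (dec (fun t => π (z t)) j t) ≤ n * c k then 0 else 1)
        ≤ δ := by
  set r := outputPmf π p W with hr
  have hr0 : ∀ s y, 0 ≤ r s y := outputPmf_nonneg (π := π) hp hW
  let q : Z → ℝ := fun z => σ (π z) * p z
  have hq : ∀ z, 0 ≤ q z := fun z => mul_nonneg (hσ _) (hp z).le
  have hq1 : ∑ z, q z = 1 := sum_source hσ1 hp1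
  let Q : Z × Y → ℝ := fun ω => q ω.1 * W ω.1 ω.2
  have hQ : ∀ ω, 0 ≤ Q ω := fun ω => mul_nonneg (hq _) (hW _ _)
  have hQsum : ∀ g : Z → Y → ℝ, ∑ ω, Q ω * g ω.1 ω.2 = ∑ z, q z * ∑ y, W z y * g z y := by
    intro g
    rw [Fintype.sum_prod_type]
    simp only [Q, Finset.mul_sum, mul_assoc]
  have hQ1 : ∑ ω, Q ω = 1 := by
    have := hQsum fun _ _ => 1
    simpa [hW1, hq1] using this
  -- The information density joins the given averages under the index `none`, with threshold `γ`, so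
  -- one tail bound covers everything.
  let F : Option K → Z → Y → ℝ := fun o => o.elim (fun z y => Real.logb 2 (W z y / r (π z) y)) f
  let C : Option K → ℝ := fun o => o.elim γ c
  have hFC : ∀ o, ∑ ω, Q ω * F o ω.1 ω.2 < C o := by
    intro o
    rw [hQsum]
    cases o with
    | none => exact hγ
    | some k => exact hc k
  have htail := tendsto_sum_not_forall hQ hQ1 (fun o ω => F o ω.1 ω.2) hFC
  have hexp : Tendsto (fun n : ℕ => Real.exp (-((2 : ℝ) ^ (γ' - γ)) ^ n)) atTop (𝓝 0) := by
    refine Real.tendsto_exp_neg_atTop_nhds_zero.comp (tendsto_pow_atTop_atTop_of_one_lt ?_)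
    exact Real.one_lt_rpow one_lt_two (sub_pos.2 hγ')
  have hsum := htail.add hexp
  rw [add_zero] at hsum
  filter_upwards [hsum.eventually (gt_mem_nhds hδ)] with n hn M hM
  obtain ⟨good, hgood⟩ : ∃ good : (Fin n → Z) → (Fin n → Y) → Prop,
      ∀ z y, good z y ↔ ∀ o, ∑ t, F o (z t) (y t) ≤ n * C o := ⟨_, fun _ _ => Iff.rfl⟩
  -- The source law restricted to blocks with side information `s`: the decoder knows `s`, so each
  -- `s` gets its own codebook.
  let w : (Fin n → S) → (Fin n → Z) → ℝ := fun s z =>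
    if (fun t => π (z t)) = s then ∏ t, q (z t) else 0
  have hw : ∀ s z, 0 ≤ w s z := fun s z => by
    simp only [w]; split_ifs
    · exact Finset.prod_nonneg fun t _ => hq _
    · exact le_rfl
  have hbook : ∀ s : Fin n → S, ∃ C : Fin M → Fin n → Y,
      ∑ z, w s z * (if ∃ j, good z (C j) then 0 else 1) ≤
        ∑ z, w s z * (∑ y : Fin n → Y, (∏ t, W (z t) (y t)) * if good z y then 0 else 1) +
          (∑ z, w s z) * Real.exp (-(M * (2 : ℝ) ^ (-(n * γ)))) := by
    intro s
    have hV1 : ∀ z : Fin n → Z, ∑ y : Fin n → Y, ∏ t, W (z t) (y t) = 1 :=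
      fun z => sum_prod_eq_one (w := fun t => W (z t)) fun t => hW1 (z t)
    have hR1 : ∑ y : Fin n → Y, ∏ t, r (s t) (y t) = 1 :=
      sum_prod_eq_one (w := fun t => r (s t)) fun t => sum_outputPmf hp1 hW1 (s t)
    have hF : ∀ z y, w s z ≠ 0 → good z y →
        (2 : ℝ) ^ (-(n * γ)) * ∏ t, W (z t) (y t) ≤ ∏ t, r (s t) (y t) := by
      intro z y hz hzy
      have hs : (fun t => π (z t)) = s := by
        by_contra h
        exact hz (by simp [w, h])
      subst hs
      exact mul_prod_le_prod_outputPmf hp hW z y ((hgood z y).1 hzy none)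
    clear_value w r
    exact exists_codebook (p := w s)
        (V := fun (z : Fin n → Z) (y : Fin n → Y) => ∏ t, W (z t) (y t))
        (R := fun y : Fin n → Y => ∏ t, r (s t) (y t)) (F := good) (u := (2 : ℝ) ^ (-(n * γ))) (hw s)
        (fun z y => Finset.prod_nonneg fun t _ => hW _ _) hV1
        (fun y => Finset.prod_nonneg fun t _ => hr0 (s t) (y t)) hR1 hF M
  choose dec hdec using hbook
  have hwsum : ∀ (G : (Fin n → S) → (Fin n → Z) → ℝ),
      ∑ s, ∑ z, w s z * G s z = ∑ z, (∏ t, q (z t)) * G (fun t => π (z t)) z := by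
    intro G
    rw [Finset.sum_comm]
    refine Finset.sum_congr rfl fun z _ => ?_
    rw [Finset.sum_eq_single (fun t => π (z t))]
    · simp [w]
    · intro s _ hs; simp [w, hs.symm]
    · simp
  refine ⟨dec, ?_⟩
  have hstep : ∑ z : Fin n → Z, (∏ t, q (z t)) *
      (if ∃ j, good z (dec (fun t => π (z t)) j) then 0 else 1) ≤ δ := by
    have h1 := Finset.sum_le_sum fun s (_ : s ∈ univ) => hdec s
    have h3 : ∑ s, ∑ z, w s z * (if ∃ j, good z (dec s j) then (0 : ℝ) else 1) =
        ∑ z, (∏ t, q (z t)) * (if ∃ j, good z (dec (fun t => π (z t)) j) then (0 : ℝ) else 1) :=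
      hwsum fun s z => if ∃ j, good z (dec s j) then (0 : ℝ) else 1
    have h4 : ∑ s, ∑ z, w s z *
          (∑ y : Fin n → Y, (∏ t, W (z t) (y t)) * if good z y then (0 : ℝ) else 1) =
        ∑ z, (∏ t, q (z t)) *
          (∑ y : Fin n → Y, (∏ t, W (z t) (y t)) * if good z y then (0 : ℝ) else 1) :=
      hwsum fun _ z => ∑ y : Fin n → Y, (∏ t, W (z t) (y t)) * if good z y then (0 : ℝ) else 1
    rw [h3, Finset.sum_add_distrib,
      h4, ← Finset.sum_mul] at h1
    have h2 := hwsum fun _ _ => 1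
    simp only [mul_one] at h2
    rw [h2, sum_prod_eq_one (fun _ => hq1), one_mul] at h1
    refine h1.trans (le_trans (add_le_add (le_of_eq ?_) ?_) hn.le)
    · rw [sum_arrow_prod]
      refine Finset.sum_congr rfl fun z _ => ?_
      rw [Finset.mul_sum]
      refine Finset.sum_congr rfl fun y _ => ?_
      rw [← mul_assoc, ← Finset.prod_mul_distrib]
      simp only [hgood, Q]
    -- Since `M ≥ 2 ^ (n * γ')`, the codebook failure is doubly exponentially small in `n`.
    · rw [Real.exp_le_exp, neg_le_neg_iff, ← Real.rpow_mul_natCast two_pos.le]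
      calc (2 : ℝ) ^ ((γ' - γ) * n) = (2 : ℝ) ^ (n * γ') * (2 : ℝ) ^ (-(n * γ)) := by
            rw [← Real.rpow_add two_pos]; congr 1; ring
        _ ≤ _ := mul_le_mul_of_nonneg_right hM (Real.rpow_nonneg two_pos.le _)
  refine le_trans (Finset.sum_le_sum fun z _ => ?_) hstep
  refine mul_le_mul_of_nonneg_left ?_ (Finset.prod_nonneg fun t _ => hq _)
  split_ifs with h1 h2 h2
  · exact le_rfl
  · exact zero_le_one
  · obtain ⟨j, hj⟩ := h2
    exact absurd ⟨j, fun k => (hgood _ _).1 hj (some k)⟩ h1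
  · exact le_rfl

open scoped Classical in
/-- Universal coding: one code that performs well for all the sources of a finite family. -/
theorem eventually_exists_code [Fintype S] [Fintype Y] {π : Z → S} {σ : S → ℝ}
    (hσ : ∀ s, 0 < σ s) (hσ1 : ∑ s, σ s = 1)
    {T Θ : Type*} [Fintype T] [Nonempty T] [Fintype Θ] (atom : Θ → T)
    {p : T → Z → ℝ} (hp : ∀ a z, 0 < p a z) (hinj : Function.Injective p)
    (hp1 : ∀ a s, ∑ z ∈ univ.filter (fun z => π z = s), p a z = 1)
    {W : T → Z → Y → ℝ} (hW : ∀ a z y, 0 ≤ W a z y) (hW1 : ∀ a z, ∑ y, W a z y = 1)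
    {D : Θ → Z → Y → ℝ} (hD : ∀ τ z y, 0 ≤ D τ z y)
    {γ : ℝ} (hγ0 : 0 < γ) (hγ : ∀ a, sideInfo π σ (p a) (W a) < γ) {ε : ℝ} (hε : 0 < ε) :
    ∀ᶠ n : ℕ in atTop, ∃ (J : ℕ) (f : (Fin n → Z) → Fin J) (dec : (Fin n → S) → Fin J → Fin n → Y),
      1 / (n : ℝ) * Real.logb 2 J < γ ∧ ∀ τ,
        ∑ z : Fin n → Z, (∏ t, σ (π (z t)) * p (atom τ) (z t)) *
          (1 / (n : ℝ) * ∑ t, D τ (z t) (dec (fun t => π (z t)) (f z) t)) ≤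
        ∑ z, σ (π z) * p (atom τ) z * ∑ y, W (atom τ) z y * D τ z y + ε := by
  have hσ0 : ∀ s, 0 ≤ σ s := fun s => (hσ s).le
  let q : T → Z → ℝ := fun a z => σ (π z) * p a z
  have hq : ∀ a z, 0 ≤ q a z := fun a z => mul_nonneg (hσ0 _) (hp a z).le
  have hq1 : ∀ a, ∑ z, q a z = 1 := fun a => sum_source hσ1 (hp1 a)
  -- Full support of `σ` is essential: a sampling set of zero probability could be the only one that
  -- separates two atoms.
  have hqinj : Function.Injective q := by
    intro a b hab
    refine hinj (funext fun z => ?_)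
    exact mul_left_cancel₀ (hσ (π z)).ne' (congrFun hab z)
  -- The maximum with 0 keeps the codebook exponent positive, so that rounding up `2 ^ (n * γ₂)` at
  -- most doubles it.
  obtain ⟨γ₁, hγ₁0, hγ₁, hγ₁γ⟩ : ∃ γ₁, 0 < γ₁ ∧ (∀ a, sideInfo π σ (p a) (W a) < γ₁) ∧ γ₁ < γ := by
    obtain ⟨a, ha⟩ := Finite.exists_max fun a => sideInfo π σ (p a) (W a)
    have h1 := hγ a
    have h2 : max (sideInfo π σ (p a) (W a)) 0 < γ := max_lt h1 hγ0
    refine ⟨(max (sideInfo π σ (p a) (W a)) 0 + γ) / 2, ?_, fun b => ?_, by linarith⟩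
    · have := le_max_right (sideInfo π σ (p a) (W a)) 0
      linarith
    · have := le_max_left (sideInfo π σ (p a) (W a)) 0
      have := ha b
      linarith
  obtain ⟨γ₂, hγ₂, hγ₂γ⟩ := exists_between hγ₁γ
  have hγ₂0 : 0 < γ₂ := hγ₁0.trans hγ₂
  let E : T → Θ → ℝ := fun a τ => ∑ z, q a z * ∑ y, W a z y * D τ z y
  have hE : ∀ a τ, 0 ≤ E a τ := fun a τ => Finset.sum_nonneg fun z _ =>
    mul_nonneg (hq a z) (Finset.sum_nonneg fun y _ => mul_nonneg (hW a z y) (hD τ z y))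
  obtain ⟨L, hL0, hL⟩ : ∃ L : ℝ, 0 < L ∧ ∀ τ z y, D τ z y ≤ L := by
    refine ⟨1 + ∑ τ, ∑ z, ∑ y, D τ z y, ?_, fun τ z y => ?_⟩
    · have : 0 ≤ ∑ τ, ∑ z, ∑ y, D τ z y := Finset.sum_nonneg fun τ _ =>
        Finset.sum_nonneg fun z _ => Finset.sum_nonneg fun y _ => hD τ z y
      linarith
    · have h1 := Finset.single_le_sum (fun y _ => hD τ z y) (mem_univ y)
      have h2 := Finset.single_le_sum (f := fun z => ∑ y, D τ z y)
        (fun z _ => Finset.sum_nonneg fun y _ => hD τ z y) (mem_univ z)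
      have h3 := Finset.single_le_sum (f := fun τ => ∑ z, ∑ y, D τ z y)
        (fun τ _ => Finset.sum_nonneg fun z _ => Finset.sum_nonneg fun y _ => hD τ z y)
        (mem_univ τ)
      linarith
  -- Two failure events, wrong atom and no good codeword, each cost at most `L`; together they use
  -- `ε / 2`, and the covering slack uses the other half.
  have hδ : 0 < ε / (4 * L) := by positivity
  have hcover : ∀ᶠ n : ℕ in atTop, ∀ a : T, ∀ M : ℕ, (2 : ℝ) ^ (n * γ₂) ≤ M →
      ∃ dec : (Fin n → S) → Fin M → Fin n → Y,
        ∑ z : Fin n → Z, (∏ t, q a (z t)) *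
          (if ∃ j, ∀ τ, ∑ t, D τ (z t) (dec (fun t => π (z t)) j t) ≤ n * (E a τ + ε / 2)
            then 0 else 1)
        ≤ ε / (4 * L) :=
    eventually_all.2 fun a => eventually_exists_cover hσ0 hσ1 (hp a) (hp1 a) (hW a) (hW1 a) D
      (c := fun τ => E a τ + ε / 2) (fun τ => by simp only [E, q]; linarith) (hγ₁ a) hγ₂ hδ
  -- The factor `card T` pays for the estimate, the factor 2 for rounding.
  have hrate : ∀ᶠ n : ℕ in atTop, 1 / (n : ℝ) * Real.logb 2 (2 * Fintype.card T) + γ₂ < γ := by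
    have : Tendsto (fun n : ℕ => 1 / (n : ℝ) * Real.logb 2 (2 * Fintype.card T) + γ₂) atTop
        (𝓝 (0 * Real.logb 2 (2 * Fintype.card T) + γ₂)) :=
      (tendsto_one_div_atTop_nhds_zero_nat.mul_const _).add_const _
    rw [zero_mul, zero_add] at this
    exact this.eventually (gt_mem_nhds hγ₂γ)
  filter_upwards [hcover, hrate, eventually_gt_atTop 0,
    eventually_exists_test hq hq1 hqinj hδ] with n hcov hr hn ⟨est, hest⟩
  have hn' : (0 : ℝ) < n := Nat.cast_pos.2 hn
  set M := ⌈(2 : ℝ) ^ (n * γ₂)⌉₊ with hM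
  have h2pos : (0 : ℝ) < 2 ^ (n * γ₂) := Real.rpow_pos_of_pos two_pos _
  have hMpos : 0 < M := Nat.ceil_pos.2 h2pos
  choose book hbook using fun a => hcov a M (Nat.le_ceil _)
  let good : T → (Fin n → Z) → Fin M → Prop := fun a z j =>
    ∀ τ, ∑ t, D τ (z t) (book a (fun t => π (z t)) j t) ≤ n * (E a τ + ε / 2)
  let sel : T → (Fin n → Z) → Fin M := fun a z =>
    if h : ∃ j, good a z j then h.choose else ⟨0, hMpos⟩
  -- A message is a pair: estimated atom and codeword index.
  let e : T × Fin M ≃ Fin (Fintype.card T * M) :=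
    ((Fintype.equivFin T).prodCongr (Equiv.refl _)).trans finProdFinEquiv
  refine ⟨Fintype.card T * M, fun z => e (est z, sel (est z) z),
    fun s j => book (e.symm j).1 s (e.symm j).2, ?_, fun τ => ?_⟩
  · have hcT : (0 : ℝ) < Fintype.card T := Nat.cast_pos.2 Fintype.card_pos
    have hM2 : (M : ℝ) ≤ 2 * (2 : ℝ) ^ (n * γ₂) := by
      have h1 := (Nat.ceil_lt_add_one h2pos.le).le
      have h2 : (1 : ℝ) ≤ 2 ^ (n * γ₂) :=
        Real.one_le_rpow one_le_two (by positivity)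
      linarith
    have hJ : Real.logb 2 ((Fintype.card T * M : ℕ) : ℝ) ≤
        Real.logb 2 (2 * Fintype.card T) + n * γ₂ := by
      have h3 : Real.logb 2 ((2 : ℝ) ^ (n * γ₂)) = n * γ₂ :=
        Real.logb_rpow two_pos (by norm_num)
      rw [← h3, ← Real.logb_mul (by positivity) h2pos.ne']
      refine Real.logb_le_logb_of_le one_lt_two ?_ ?_
      · have : (0 : ℝ) < M := Nat.cast_pos.2 hMpos
        push_cast; positivity
      · push_cast
        have := mul_le_mul_of_nonneg_left hM2 hcT.le
        linarith
    calc 1 / (n : ℝ) * Real.logb 2 ((Fintype.card T * M : ℕ) : ℝ)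
        ≤ 1 / (n : ℝ) * (Real.logb 2 (2 * Fintype.card T) + n * γ₂) :=
          mul_le_mul_of_nonneg_left hJ (by positivity)
      _ = 1 / (n : ℝ) * Real.logb 2 (2 * Fintype.card T) + γ₂ := by field_simp
      _ < γ := hr
  · simp only [Equiv.symm_apply_apply]
    set a := atom τ with ha
    have hqn : ∀ z : Fin n → Z, 0 ≤ ∏ t, q a (z t) :=
      fun z => Finset.prod_nonneg fun t _ => hq a _
    have hpt : ∀ z : Fin n → Z,
        1 / (n : ℝ) * ∑ t, D τ (z t) (book (est z) (fun t => π (z t)) (sel (est z) z) t) ≤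
          E a τ + ε / 2 + L * (if est z = a then 0 else 1) +
            L * (if ∃ j, good a z j then 0 else 1) := by
      intro z
      have hbound : 1 / (n : ℝ) *
          ∑ t, D τ (z t) (book (est z) (fun t => π (z t)) (sel (est z) z) t) ≤ L := by
        rw [one_div, inv_mul_le_iff₀ hn']
        refine (Finset.sum_le_sum fun t _ => hL _ _ _).trans_eq ?_
        simp
      have hE' := hE a τ
      split_ifs with h1 h2
      · have h3 : good a z (sel a z) := by
          simp only [sel, dif_pos h2]
          exact h2.choose_spec
        rw [one_div, inv_mul_le_iff₀ hn', h1]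
        have := h3 τ
        linarith
      all_goals linarith
    calc ∑ z : Fin n → Z, (∏ t, q a (z t)) *
          (1 / (n : ℝ) * ∑ t, D τ (z t) (book (est z) (fun t => π (z t)) (sel (est z) z) t))
        ≤ ∑ z : Fin n → Z, (∏ t, q a (z t)) * (E a τ + ε / 2 + L * (if est z = a then 0 else 1) +
            L * (if ∃ j, good a z j then 0 else 1)) :=
          Finset.sum_le_sum fun z _ => mul_le_mul_of_nonneg_left (hpt z) (hqn z)
      _ = (E a τ + ε / 2) + L * (∑ z : Fin n → Z, (∏ t, q a (z t)) *
            (if est z = a then 0 else 1)) + L * (∑ z : Fin n → Z, (∏ t, q a (z t)) *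
            (if ∃ j, good a z j then 0 else 1)) := by
          simp only [mul_add, Finset.sum_add_distrib, ← Finset.sum_mul, mul_left_comm _ L,
            ← Finset.mul_sum, sum_prod_eq_one fun _ => hq1 a, one_mul]
      _ ≤ (E a τ + ε / 2) + L * (ε / (4 * L)) + L * (ε / (4 * L)) := by
          gcongr
          · exact hest a
          · exact hbook a
      _ = E a τ + ε := by field_simp; ring

end Achievability

end

end UniversalSampling

namespace UniversalSampling

open Finset Filter Topology

noncomputable section

/-! ### Converse for a source with side information -/

section Converse

variable {Z S Y : Type*} [Fintype Z]

-- From `1 - 1/x ≤ log x`, each term is at least `(W - r) / log 2` with `r` the output pmf, and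
-- these bounds sum to zero over `y`.
open scoped Classical in
theorem sideInfo_nonneg [Fintype Y] {π : Z → S} {σ : S → ℝ} (hσ : ∀ s, 0 ≤ σ s)
    {p : Z → ℝ} (hp : ∀ z, 0 < p z)
    (hp1 : ∀ s, ∑ z ∈ univ.filter (fun z => π z = s), p z = 1)
    {W : Z → Y → ℝ} (hW : ∀ z y, 0 ≤ W z y) (hW1 : ∀ z, ∑ y, W z y = 1) :
    0 ≤ sideInfo π σ p W := by
  have hlog : 0 < Real.log 2 := Real.log_pos one_lt_two
  refine Finset.sum_nonneg fun z _ => mul_nonneg (mul_nonneg (hσ _) (hp z).le) ?_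
  have hpt : ∀ y, (W z y - outputPmf π p W (π z) y) / Real.log 2 ≤
      W z y * Real.logb 2 (W z y / outputPmf π p W (π z) y) := by
    intro y
    rcases (hW z y).eq_or_lt with h | h
    · rw [← h, zero_mul, zero_sub]
      exact div_nonpos_of_nonpos_of_nonneg
        (neg_nonpos.2 (outputPmf_nonneg (π := π) hp hW _ _)) hlog.le
    · have hr := outputPmf_pos (π := π) hp hW h
      rw [Real.logb, ← mul_div_assoc]
      refine div_le_div_of_nonneg_right ?_ hlog.le
      have h1 := Real.one_sub_inv_le_log_of_pos (div_pos h hr)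
      have h2 := mul_le_mul_of_nonneg_left h1 h.le
      refine le_trans (le_of_eq ?_) h2
      field_simp
  refine le_trans (le_of_eq ?_) (Finset.sum_le_sum fun y _ => hpt y)
  rw [← Finset.sum_div, Finset.sum_sub_distrib, hW1, sum_outputPmf hp1 hW1, sub_self, zero_div]

open scoped Classical in
/-- The expected likelihood ratio, along the decoder outputs, is at most the number of
messages. -/
theorem sum_likelihoodRatio_le [Fintype S] {n : ℕ} {π : Z → S} {σ : Fin n → S → ℝ}
    (hσ : ∀ t s, 0 ≤ σ t s)
    (hσ1 : ∀ t, ∑ s, σ t s = 1) {p : Z → ℝ} (hp : ∀ z, 0 < p z)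
    {W : Z → Y → ℝ} (hW : ∀ z y, 0 ≤ W z y)
    {J : ℕ} (f : (Fin n → Z) → Fin J) (dec : (Fin n → S) → Fin J → Fin n → Y) :
    ∑ z : Fin n → Z, (∏ t, σ t (π (z t)) * p (z t)) *
      ∏ t, W (z t) (dec (fun t => π (z t)) (f z) t) /
        outputPmf π p W (π (z t)) (dec (fun t => π (z t)) (f z) t) ≤ J := by
  have hr : ∀ s y, 0 ≤ outputPmf π p W s y := outputPmf_nonneg (π := π) hp hW
  have hq : ∀ z : Fin n → Z, 0 ≤ ∏ t, σ t (π (z t)) * p (z t) :=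
    fun z => Finset.prod_nonneg fun t _ => mul_nonneg (hσ _ _) (hp _).le
  -- With the message fixed, the reproduction depends only on the side information; given that, the
  -- expectation factorizes and each channel factor averages to the output pmf.
  have h1 : ∀ j : Fin J, ∑ z : Fin n → Z, (∏ t, σ t (π (z t)) * p (z t)) *
      ∏ t, W (z t) (dec (fun t => π (z t)) j t) /
        outputPmf π p W (π (z t)) (dec (fun t => π (z t)) j t) ≤ 1 := by
    intro j
    rw [sum_eq_sum_fiber π]
    have hs1 : ∑ s : Fin n → S, ∏ t, σ t (s t) = 1 := sum_prod_eq_one hσ1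
    rw [← hs1]
    refine Finset.sum_le_sum fun s _ => ?_
    have h2 : ∀ z ∈ Fintype.piFinset (fun t => univ.filter fun z => π z = s t),
        (∏ t, σ t (π (z t)) * p (z t)) * ∏ t, W (z t) (dec (fun t => π (z t)) j t) /
          outputPmf π p W (π (z t)) (dec (fun t => π (z t)) j t) =
        ∏ t, σ t (s t) * (p (z t) * W (z t) (dec s j t)) /
          outputPmf π p W (s t) (dec s j t) := by
      intro z hz
      have hz' : (fun t => π (z t)) = s := by
        funext t
        simpa using Fintype.mem_piFinset.1 hz t
      subst hz'
      rw [← Finset.prod_mul_distrib]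
      refine Finset.prod_congr rfl fun t _ => ?_
      ring
    rw [Finset.sum_congr rfl h2, ← Finset.prod_univ_sum (fun t => univ.filter fun z => π z = s t)
      (fun t z => σ t (s t) * (p z * W z (dec s j t)) / outputPmf π p W (s t) (dec s j t))]
    refine Finset.prod_le_prod (fun t _ => Finset.sum_nonneg fun z _ => div_nonneg
      (mul_nonneg (hσ _ _) (mul_nonneg (hp _).le (hW _ _))) (hr _ _)) fun t _ => ?_
    rw [← Finset.sum_div, ← Finset.mul_sum]
    change σ t (s t) * outputPmf π p W (s t) (dec s j t) / outputPmf π p W (s t) (dec s j t) ≤ _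
    -- The ratio is 1, or 0 where the output pmf vanishes.
    rw [mul_div_assoc]
    exact mul_le_of_le_one_right (hσ _ _) (div_self_le_one _)
  calc _ ≤ ∑ z : Fin n → Z, (∏ t, σ t (π (z t)) * p (z t)) *
      ∑ j, ∏ t, W (z t) (dec (fun t => π (z t)) j t) /
        outputPmf π p W (π (z t)) (dec (fun t => π (z t)) j t) := by
        refine Finset.sum_le_sum fun z _ => mul_le_mul_of_nonneg_left ?_ (hq z)
        exact Finset.single_le_sum (f := fun j => ∏ t, W (z t) (dec (fun t => π (z t)) j t) /
          outputPmf π p W (π (z t)) (dec (fun t => π (z t)) j t))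
          (fun j _ => Finset.prod_nonneg fun t _ => div_nonneg (hW _ _) (hr _ _)) (mem_univ (f z))
    _ = ∑ j : Fin J, ∑ z : Fin n → Z, (∏ t, σ t (π (z t)) * p (z t)) *
      ∏ t, W (z t) (dec (fun t => π (z t)) j t) /
        outputPmf π p W (π (z t)) (dec (fun t => π (z t)) j t) := by
        simp only [Finset.mul_sum]
        rw [Finset.sum_comm]
    _ ≤ ∑ j : Fin J, 1 := Finset.sum_le_sum fun j _ => h1 j
    _ = J := by simp

open scoped Classical in
/-- Single-letterization: the averaged test channel of a code has exactly the distortions of the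
code, and its mutual information is at most the rate. -/
theorem exists_channel_of_code [Fintype S] [Fintype Y] [Nonempty Y] {n : ℕ} (hn : 0 < n)
    {π : Z → S} {σ : Fin n → S → ℝ}
    (hσ : ∀ t s, 0 ≤ σ t s) (hσ1 : ∀ t, ∑ s, σ t s = 1) {p : Z → ℝ} (hp : ∀ z, 0 < p z)
    (hp1 : ∀ s, ∑ z ∈ univ.filter (fun z => π z = s), p z = 1)
    {J : ℕ} (f : (Fin n → Z) → Fin J) (dec : (Fin n → S) → Fin J → Fin n → Y) :
    ∃ W : Z → Y → ℝ, (∀ z y, 0 ≤ W z y) ∧ (∀ z, ∑ y, W z y = 1) ∧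
      (∀ D : Z → Y → ℝ, ∑ z : Fin n → Z, (∏ t, σ t (π (z t)) * p (z t)) *
          (1 / (n : ℝ) * ∑ t, D (z t) (dec (fun t => π (z t)) (f z) t)) =
        ∑ z, (1 / (n : ℝ) * ∑ t, σ t (π z)) * p z * ∑ y, W z y * D z y) ∧
      sideInfo π (fun s => 1 / (n : ℝ) * ∑ t, σ t s) p W ≤ 1 / (n : ℝ) * Real.logb 2 J := by
  have hn' : (0 : ℝ) < n := Nat.cast_pos.2 hn
  set Q : (Fin n → Z) → ℝ := fun z => ∏ t, σ t (π (z t)) * p (z t) with hQdef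
  set g : (Fin n → Z) → Fin n → Y := fun z => dec (fun t => π (z t)) (f z) with hg
  have hQ : ∀ z, 0 ≤ Q z := fun z => Finset.prod_nonneg fun t _ => mul_nonneg (hσ _ _) (hp _).le
  have hq1 : ∀ t, ∑ z, σ t (π z) * p z = 1 := fun t => sum_source (hσ1 t) hp1
  have hQ1 : ∑ z, Q z = 1 := sum_prod_eq_one (w := fun t z => σ t (π z) * p z) hq1
  -- `N` is the expected number of instants showing the pair `(z₀, y)`, and `M` its marginal count;
  -- the averaged channel is their ratio.
  let N : Z → Y → ℝ := fun z₀ y => ∑ t, ∑ z, Q z * if z t = z₀ ∧ g z t = y then 1 else 0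
  let M : Z → ℝ := fun z₀ => (∑ t, σ t (π z₀)) * p z₀
  have hN0 : ∀ z₀ y, 0 ≤ N z₀ y := fun z₀ y => Finset.sum_nonneg fun t _ =>
    Finset.sum_nonneg fun z _ => mul_nonneg (hQ z) (by split_ifs <;> simp)
  have hM0 : ∀ z₀, 0 ≤ M z₀ := fun z₀ =>
    mul_nonneg (Finset.sum_nonneg fun t _ => hσ _ _) (hp _).le
  have hNM : ∀ z₀, ∑ y, N z₀ y = M z₀ := by
    intro z₀
    simp only [N, M]
    rw [Finset.sum_comm, Finset.sum_mul]
    refine Finset.sum_congr rfl fun t _ => ?_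
    rw [Finset.sum_comm]
    have := sum_prod_mul_apply (fun t z => σ t (π z) * p z) hq1
      (fun z => if z = z₀ then 1 else 0) t
    simp only [mul_ite, mul_one, mul_zero, Finset.sum_ite_eq', mem_univ, if_true] at this
    rw [← this]
    refine Finset.sum_congr rfl fun z _ => ?_
    by_cases h : z t = z₀
    · simp [h, hQdef]
    · simp [h]
  have hND : ∀ D : Z → Y → ℝ, ∑ z₀, ∑ y, N z₀ y * D z₀ y = ∑ z, Q z * ∑ t, D (z t) (g z t) := by
    intro D
    calc ∑ z₀, ∑ y, N z₀ y * D z₀ y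
        = ∑ ω : Z × Y, ∑ t, ∑ z, Q z * (if z t = ω.1 ∧ g z t = ω.2 then 1 else 0) * D ω.1 ω.2 := by
          rw [Fintype.sum_prod_type]
          simp only [N, Finset.sum_mul]
      _ = ∑ t, ∑ z, ∑ ω : Z × Y,
            Q z * (if z t = ω.1 ∧ g z t = ω.2 then 1 else 0) * D ω.1 ω.2 := by
          rw [Finset.sum_comm]
          exact Finset.sum_congr rfl fun t _ => Finset.sum_comm
      _ = ∑ t, ∑ z, Q z * D (z t) (g z t) := by
          refine Finset.sum_congr rfl fun t _ => Finset.sum_congr rfl fun z _ => ?_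
          rw [Finset.sum_eq_single (z t, g z t)]
          · simp
          · rintro ⟨z₀, y⟩ _ h
            rw [if_neg, mul_zero, zero_mul]
            rintro ⟨h1, h2⟩
            exact h (by simp [h1, h2])
          · simp
      _ = _ := by
          rw [Finset.sum_comm]
          simp only [Finset.mul_sum]
  obtain ⟨y₀⟩ := ‹Nonempty Y›
  -- Letters that never occur get an arbitrary point mass.
  let W : Z → Y → ℝ := fun z₀ y => if M z₀ = 0 then (if y = y₀ then 1 else 0) else N z₀ y / M z₀
  have hW : ∀ z y, 0 ≤ W z y := by
    intro z y
    simp only [W]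
    split_ifs
    · exact zero_le_one
    · exact le_rfl
    · exact div_nonneg (hN0 _ _) (hM0 _)
  have hW1 : ∀ z, ∑ y, W z y = 1 := by
    intro z
    by_cases h : M z = 0
    · simp [W, h]
    · simp only [W, h, if_false]
      rw [← Finset.sum_div, hNM, div_self h]
  have hMW : ∀ z y, M z * W z y = N z y := by
    intro z y
    by_cases h : M z = 0
    · have := (Finset.sum_eq_zero_iff_of_nonneg fun y _ => hN0 z y).1 ((hNM z).trans h) y
        (mem_univ y)
      rw [h, zero_mul, this]
    · simp only [W, h, if_false]
      field_simp
  have hdist : ∀ D : Z → Y → ℝ, ∑ z : Fin n → Z, Q z * (1 / (n : ℝ) * ∑ t, D (z t) (g z t)) =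
      ∑ z, (1 / (n : ℝ) * ∑ t, σ t (π z)) * p z * ∑ y, W z y * D z y := by
    intro D
    calc _ = 1 / (n : ℝ) * ∑ z, Q z * ∑ t, D (z t) (g z t) := by
          rw [Finset.mul_sum]
          exact Finset.sum_congr rfl fun z _ => by ring
      _ = ∑ z, ∑ y, 1 / (n : ℝ) * (M z * W z y * D z y) := by
          rw [← hND D]
          simp only [Finset.mul_sum, hMW]
      _ = _ := by
          refine Finset.sum_congr rfl fun z _ => ?_
          rw [Finset.mul_sum]
          refine Finset.sum_congr rfl fun y _ => ?_
          simp only [M]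
          ring
  refine ⟨W, hW, hW1, hdist, ?_⟩
  have hJ : (0 : ℝ) < J := by
    have : Nonempty (Fin n → Z) := by
      by_contra h
      rw [not_nonempty_iff] at h
      simp at hQ1
    obtain ⟨z⟩ := this
    exact Nat.cast_pos.2 ((Nat.zero_le _).trans_lt (f z).isLt)
  have hlog : 0 < Real.log 2 := Real.log_pos one_lt_two
  set r := outputPmf π p W with hr
  set L : (Fin n → Z) → ℝ := fun z => ∏ t, W (z t) (g z t) / r (π (z t)) (g z t) with hL
  have hEL : ∑ z, Q z * L z ≤ J := sum_likelihoodRatio_le hσ hσ1 hp hW f dec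
  have hpt : ∀ z, Q z * ∑ t, Real.logb 2 (W (z t) (g z t) / r (π (z t)) (g z t)) ≤
      Q z * (Real.logb 2 J + (L z / J - 1) / Real.log 2) := by
    intro z
    rcases (hQ z).eq_or_lt with h | h
    · rw [← h, zero_mul, zero_mul]
    refine mul_le_mul_of_nonneg_left ?_ h.le
    -- A block of positive probability contributes to the count of each of its own letter pairs.
    have hpos : ∀ t, 0 < W (z t) (g z t) := by
      intro t
      refine pos_of_mul_pos_right (a := M (z t)) ?_ (hM0 _)
      rw [hMW]
      refine h.trans_le ?_
      have h1 := Finset.single_le_sum (f := fun z' => Q z' *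
        if z' t = z t ∧ g z' t = g z t then 1 else 0)
        (fun z' _ => mul_nonneg (hQ z') (by split_ifs <;> simp)) (mem_univ z)
      have h2 := Finset.single_le_sum (f := fun t' => ∑ z', Q z' *
        if z' t' = z t ∧ g z' t' = g z t then 1 else 0)
        (fun t' _ => Finset.sum_nonneg fun z' _ => mul_nonneg (hQ z') (by split_ifs <;> simp))
        (mem_univ t)
      refine le_trans (le_of_eq ?_) (h1.trans h2)
      simp
    have hLpos : ∀ t, 0 < W (z t) (g z t) / r (π (z t)) (g z t) := fun t =>
      div_pos (hpos t) (outputPmf_pos hp hW (hpos t))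
    rw [← Real.logb_prod _ _ fun t _ => (hLpos t).ne']
    have hL0 : 0 < L z := Finset.prod_pos fun t _ => hLpos t
    change Real.logb 2 (L z) ≤ _
    -- The tangent to the logarithm at `J`; its linear correction has nonpositive expectation by
    -- `hEL`.
    have h1 := Real.log_le_sub_one_of_pos (div_pos hL0 hJ)
    rw [Real.log_div hL0.ne' hJ.ne'] at h1
    rw [Real.logb, Real.logb, ← add_div]
    refine div_le_div_of_nonneg_right ?_ hlog.le
    linarith
  have hinfo := hdist fun z y => Real.logb 2 (W z y / r (π z) y)
  unfold sideInfo
  rw [← hr, ← hinfo]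
  calc ∑ z, Q z * (1 / (n : ℝ) * ∑ t, Real.logb 2 (W (z t) (g z t) / r (π (z t)) (g z t)))
      = 1 / (n : ℝ) * ∑ z, Q z * ∑ t, Real.logb 2 (W (z t) (g z t) / r (π (z t)) (g z t)) := by
        rw [Finset.mul_sum]
        exact Finset.sum_congr rfl fun z _ => by ring
    _ ≤ 1 / (n : ℝ) * ∑ z, Q z * (Real.logb 2 J + (L z / J - 1) / Real.log 2) :=
        mul_le_mul_of_nonneg_left (Finset.sum_le_sum fun z _ => hpt z) (by positivity)
    _ = 1 / (n : ℝ) * (Real.logb 2 J + ((∑ z, Q z * L z) / J - 1) / Real.log 2) := by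
        congr 1
        have : ∀ z, Q z * (Real.logb 2 J + (L z / J - 1) / Real.log 2) =
            Q z * (Real.logb 2 J - 1 / Real.log 2) + Q z * L z * (1 / (J * Real.log 2)) := by
          intro z
          field_simp
          ring
        simp only [this, Finset.sum_add_distrib, ← Finset.sum_mul, hQ1]
        field_simp
        ring
    _ ≤ 1 / (n : ℝ) * Real.logb 2 J := by
        refine mul_le_mul_of_nonneg_left ?_ (by positivity)
        have : ((∑ z, Q z * L z) / J - 1) / Real.log 2 ≤ 0 :=
          div_nonpos_of_nonpos_of_nonneg (sub_nonpos.2 ((div_le_one hJ).2 hEL)) hlog.le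
        linarith

end Converse

end

end UniversalSampling

namespace UniversalSampling

open Finset Filter Topology

noncomputable section

/-! ### Sampled sources as sources with side information -/

section Translation

variable {m k : ℕ} {X Y : Fin m → Type*} {Θ : Type*} {B : Finset (Fin m)}

theorem proj_surjective [∀ i, Nonempty (X i)] (A : Finset (Fin m)) :
    Function.Surjective (proj (Z := X) A) := by
  classical
  intro a
  refine ⟨fun i => if h : i ∈ A then a ⟨i, h⟩ else Classical.arbitrary _, ?_⟩
  funext i
  simp [proj]

/-- What the encoder sees at one instant: the sampling set and the sampled components. -/
abbrev Sample (k : ℕ) (X : Fin m → Type*) := (A : SampleSet m k) × SubAlph X A.1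

variable [∀ i, Fintype (X i)]

theorem sum_sample_filter (f : Sample k X → ℝ) (A : SampleSet m k)
    [DecidablePred fun z : Sample k X => z.1 = A] :
    ∑ z ∈ univ.filter (fun z : Sample k X => z.1 = A), f z = ∑ a, f ⟨A, a⟩ := by
  rw [Finset.sum_filter, Fintype.sum_sigma, Finset.sum_eq_single A]
  · simp
  · intro A' _ h; simp [h]
  · simp

theorem sum_marginal_mul (p : (∀ i, X i) → ℝ) (A : Finset (Fin m)) (h : SubAlph X A → ℝ) :
    ∑ a, marginal p A a * h a = ∑ x, p x * h (proj A x) := by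
  classical
  simp only [marginal, Finset.sum_mul]
  rw [Finset.sum_comm]
  refine Finset.sum_congr rfl fun x _ => ?_
  simp

theorem sum_marginal {p : (∀ i, X i) → ℝ} (hp1 : ∑ x, p x = 1) (A : Finset (Fin m)) :
    ∑ a, marginal p A a = 1 := by
  have := sum_marginal_mul p A fun _ => 1
  simpa [hp1] using this

theorem marginal_pos [∀ i, Nonempty (X i)] {p : (∀ i, X i) → ℝ} (hp : ∀ x, 0 < p x)
    (A : Finset (Fin m)) (a : SubAlph X A) : 0 < marginal p A a := by
  obtain ⟨x, rfl⟩ := proj_surjective A a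
  refine Finset.sum_pos' (fun y _ => ?_) ⟨x, mem_univ _, by simp [hp]⟩
  split_ifs
  · exact (hp y).le
  · exact le_rfl

open scoped Classical in
/-- `E[d(X_B, y) | X_A = a]`. -/
def condDist (p : (∀ i, X i) → ℝ) (d : SubAlph X B → SubAlph Y B → ℝ) (z : Sample k X)
    (y : SubAlph Y B) : ℝ :=
  (∑ x, if proj z.1.1 x = z.2 then p x * d (proj B x) y else 0) / marginal p z.1.1 z.2

theorem condDist_nonneg {p : (∀ i, X i) → ℝ} (hp : ∀ x, 0 < p x)
    {d : SubAlph X B → SubAlph Y B → ℝ} (hd : ∀ x y, 0 ≤ d x y) (z : Sample k X)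
    (y : SubAlph Y B) : 0 ≤ condDist p d z y := by
  refine div_nonneg (Finset.sum_nonneg fun x _ => ?_) (Finset.sum_nonneg fun x _ => ?_)
  · split_ifs
    · exact mul_nonneg (hp x).le (hd _ _)
    · exact le_rfl
  · split_ifs
    · exact (hp x).le
    · exact le_rfl

open scoped Classical in
theorem marginal_mul_condDist [∀ i, Nonempty (X i)] {p : (∀ i, X i) → ℝ} (hp : ∀ x, 0 < p x)
    (d : SubAlph X B → SubAlph Y B → ℝ) (z : Sample k X) (y : SubAlph Y B) :
    marginal p z.1.1 z.2 * condDist p d z y =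
      ∑ x, if proj z.1.1 x = z.2 then p x * d (proj B x) y else 0 :=
  mul_div_cancel₀ _ (marginal_pos hp _ _).ne'

/-- The channel sees only the sampled components, so the distortion may first be averaged over each
fibre of `proj`. -/
theorem channelDist_eq [∀ i, Fintype (Y i)] [∀ i, Nonempty (X i)] {p : (∀ i, X i) → ℝ}
    (hp : ∀ x, 0 < p x) (d : SubAlph X B → SubAlph Y B → ℝ) (A : SampleSet m k)
    (V : Channel X Y B A.1) :
    channelDist p d A.1 V =
      ∑ a, marginal p A.1 a * ∑ y, V.1 a y * condDist p d (⟨A, a⟩ : Sample k X) y := by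
  classical
  calc channelDist p d A.1 V
      = ∑ x, ∑ a, if proj A.1 x = a then p x * ∑ y, V.1 a y * d (proj B x) y else 0 := by
        unfold channelDist
        exact Finset.sum_congr rfl fun x _ => by simp
    _ = ∑ a, ∑ y, V.1 a y * ∑ x, if proj A.1 x = a then p x * d (proj B x) y else 0 := by
        rw [Finset.sum_comm]
        refine Finset.sum_congr rfl fun a _ => ?_
        simp only [Finset.mul_sum]
        rw [Finset.sum_comm]
        refine Finset.sum_congr rfl fun x _ => ?_
        split_ifs
        · exact Finset.sum_congr rfl fun y _ => by ring
        · simp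
    _ = _ := by
        refine Finset.sum_congr rfl fun a _ => ?_
        rw [Finset.mul_sum]
        refine Finset.sum_congr rfl fun y _ => ?_
        rw [← marginal_mul_condDist hp d (⟨A, a⟩ : Sample k X) y]
        ring

theorem sum_channelDist_eq [∀ i, Fintype (Y i)] [∀ i, Nonempty (X i)] {p : (∀ i, X i) → ℝ}
    (hp : ∀ x, 0 < p x) (d : SubAlph X B → SubAlph Y B → ℝ) (PS : SampleSet m k → ℝ)
    (W : SampleChannel k X Y B) :
    ∑ A, PS A * channelDist p d A.1 (W A) =
      ∑ z : Sample k X, PS z.1 * marginal p z.1.1 z.2 *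
        ∑ y, (W z.1).1 z.2 y * condDist p d z y := by
  rw [Fintype.sum_sigma]
  refine Finset.sum_congr rfl fun A _ => ?_
  rw [channelDist_eq hp, Finset.mul_sum]
  exact Finset.sum_congr rfl fun a _ => (mul_assoc _ _ _).symm

/-- The fibre of the side information over `A` is the alphabet of `x_A`, so the conditional output
pmf given `A` is that of the single channel `W A`. -/
theorem condInfo_eq [∀ i, Fintype (Y i)] (P : Θ → (∀ i, X i) → ℝ) (PS : SampleSet m k → ℝ)
    (τ₂ : Atom k P) (W : SampleChannel k X Y B) :
    condInfo k P PS τ₂ W = sideInfo (Sigma.fst : Sample k X → SampleSet m k) PS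
      (fun z => atomMarginal k P z.1 τ₂ z.2) (fun z y => (W z.1).1 z.2 y) := by
  classical
  unfold condInfo sideInfo mutualInfo outputPmf
  rw [Fintype.sum_sigma]
  refine Finset.sum_congr rfl fun A _ => ?_
  rw [Finset.mul_sum]
  refine Finset.sum_congr rfl fun a _ => ?_
  rw [mul_assoc]
  congr 1
  rw [Finset.mul_sum]
  refine Finset.sum_congr rfl fun y _ => ?_
  dsimp only
  have h := @sum_sample_filter m k X _ (fun z : Sample k X =>
    atomMarginal k P z.1 τ₂ z.2 * (W z.1).1 z.2 y) A (fun _ => Classical.propDecidable _)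
  dsimp only at h
  rw [mul_assoc, ← h]

/-- The distortion of a code, in terms of what the encoder sees. -/
theorem distortion_eq [∀ i, Nonempty (X i)] {n : ℕ} (c : IRSCode k X Y B n)
    {p : (∀ i, X i) → ℝ} (hp : ∀ x, 0 < p x) (d : SubAlph X B → SubAlph Y B → ℝ) :
    c.distortion d p = ∑ z : Fin n → Sample k X,
      (∏ t, c.sampler t (z t).1 * marginal p (z t).1.1 (z t).2) *
        (1 / (n : ℝ) * ∑ t, condDist p d (z t) (c.dec (fun t => (z t).1) (c.enc z) t)) := by
  classical
  have hfib : ∀ (t : Fin n) (z : Sample k X) (φ : (∀ i, X i) → ℝ)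
      [DecidablePred fun a : SampleSet m k × (∀ i, X i) =>
        (⟨a.1, proj a.1.1 a.2⟩ : Sample k X) = z],
      ∑ a ∈ univ.filter (fun a : SampleSet m k × (∀ i, X i) =>
        (⟨a.1, proj a.1.1 a.2⟩ : Sample k X) = z), c.sampler t a.1 * φ a.2 =
      c.sampler t z.1 * ∑ x, if proj z.1.1 x = z.2 then φ x else 0 := by
    rintro t ⟨A, a⟩ φ _
    rw [Finset.sum_filter, Fintype.sum_prod_type, Finset.sum_eq_single A]
    · rw [Finset.mul_sum]
      refine Finset.sum_congr rfl fun x _ => ?_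
      simp
    · intro A' _ h
      refine Finset.sum_eq_zero fun x _ => if_neg fun h' => h (congrArg Sigma.fst h')
    · simp
  have hblock : ∀ t : Fin n, ∑ a : Fin n → SampleSet m k × (∀ i, X i),
      (∏ i, c.sampler i (a i).1 * p (a i).2) *
        d (proj B (a t).2) (c.output (fun i => (a i).1) (fun i => (a i).2) t) =
      ∑ z : Fin n → Sample k X, (∏ i, c.sampler i (z i).1 * marginal p (z i).1.1 (z i).2) *
        condDist p d (z t) (c.dec (fun i => (z i).1) (c.enc z) t) := by
    intro t
    -- The code depends on sets and source only through the samples. The map `f` keeps the sets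
    -- along with the message because the decoder uses both.
    refine sum_block_comp
      (fun a : SampleSet m k × (∀ i, X i) => (⟨a.1, proj a.1.1 a.2⟩ : Sample k X))
      (fun i a => c.sampler i a.1 * p a.2)
      (fun i z => c.sampler i z.1 * marginal p z.1.1 z.2)
      (fun a y => d (proj B a.2) y) (condDist p d) ?_ ?_
      (fun z : Fin n → Sample k X => ((fun i => (z i).1 : Fin n → SampleSet m k), c.enc z))
      (fun b => c.dec b.1 b.2 t) t
    · intro i z
      exact @hfib i z p (fun _ => Classical.propDecidable _)
    · intro i z y
      simp only [mul_assoc]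
      rw [marginal_mul_condDist hp]
      have := @hfib i z (fun x => p x * d (proj B x) y) (fun _ => Classical.propDecidable _)
      exact this
  calc c.distortion d p
      = ∑ a : Fin n → SampleSet m k × (∀ i, X i), (∏ i, c.sampler i (a i).1 * p (a i).2) *
        (1 / (n : ℝ) * ∑ t, d (proj B (a t).2)
          (c.output (fun i => (a i).1) (fun i => (a i).2) t)) := by
        rw [sum_arrow_prod, Finset.sum_comm]
        unfold IRSCode.distortion
        refine Finset.sum_congr rfl fun x _ => Finset.sum_congr rfl fun s _ => ?_
        rw [Finset.prod_mul_distrib, mul_comm (∏ t, p (x t))]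
    _ = 1 / (n : ℝ) * ∑ t, ∑ a : Fin n → SampleSet m k × (∀ i, X i),
        (∏ i, c.sampler i (a i).1 * p (a i).2) *
        d (proj B (a t).2) (c.output (fun i => (a i).1) (fun i => (a i).2) t) := by
        rw [Finset.sum_comm, Finset.mul_sum]
        refine Finset.sum_congr rfl fun a _ => ?_
        rw [← Finset.mul_sum]
        ring
    _ = _ := by
        simp only [hblock]
        rw [Finset.sum_comm, Finset.mul_sum]
        refine Finset.sum_congr rfl fun a _ => ?_
        rw [← Finset.mul_sum]
        ring

end Translation

/-! ### Continuity of the single-letter quantities -/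

section Continuity

/-- Rewrites the information through `x * log x`, which is continuous at 0, whereas the ratio inside
the logarithm is not; this is the source of the continuity in the channel. -/
theorem mutualInfo_eq {α β : Type*} [Fintype α] [Fintype β] {p : α → ℝ} (hp : ∀ a, 0 < p a)
    {W : α → β → ℝ} (hW : ∀ a b, 0 ≤ W a b) :
    mutualInfo p W = ((∑ a, ∑ b, p a * (W a b * Real.log (W a b))) -
      ∑ b, (∑ a, p a * W a b) * Real.log (∑ a, p a * W a b)) / Real.log 2 := by
  have h2 : ∑ b, (∑ a, p a * W a b) * Real.log (∑ a, p a * W a b) =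
      ∑ a, ∑ b, p a * W a b * Real.log (∑ a, p a * W a b) := by
    rw [Finset.sum_comm]
    exact Finset.sum_congr rfl fun b _ => by rw [Finset.sum_mul]
  rw [h2, ← Finset.sum_sub_distrib, Finset.sum_div]
  refine Finset.sum_congr rfl fun a _ => ?_
  rw [← Finset.sum_sub_distrib, Finset.sum_div]
  refine Finset.sum_congr rfl fun b _ => ?_
  rcases (hW a b).eq_or_lt with h | h
  · simp [← h]
  · have hr : 0 < ∑ a', p a' * W a' b :=
      Finset.sum_pos' (fun a' _ => mul_nonneg (hp a').le (hW a' b))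
        ⟨a, mem_univ _, mul_pos (hp a) h⟩
    rw [Real.logb, Real.log_div h.ne' hr.ne']
    ring

variable {m : ℕ} {X Y : Fin m → Type*} [∀ i, Fintype (Y i)] {B : Finset (Fin m)}

theorem Channel.continuous_coe_apply {A : Finset (Fin m)} (a : SubAlph X A) (y : SubAlph Y B) :
    Continuous fun V : Channel X Y B A => V.1 a y :=
  (continuous_apply y).comp ((continuous_apply a).comp continuous_subtype_val)

theorem continuous_mutualInfo [∀ i, Fintype (X i)] {A : Finset (Fin m)} {p : SubAlph X A → ℝ}
    (hp : ∀ a, 0 < p a) :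
    Continuous fun V : Channel X Y B A => mutualInfo p V.1 := by
  have : (fun V : Channel X Y B A => mutualInfo p V.1) = fun V =>
      ((∑ a, ∑ b, p a * (V.1 a b * Real.log (V.1 a b))) -
      ∑ b, (∑ a, p a * V.1 a b) * Real.log (∑ a, p a * V.1 a b)) / Real.log 2 :=
    funext fun V => mutualInfo_eq hp fun a b => (V.2 a).1 b
  rw [this]
  refine Continuous.div_const (Continuous.sub ?_ ?_) _
  · refine continuous_finsetSum _ fun a _ => continuous_finsetSum _ fun b _ =>
      continuous_const.mul ?_
    exact Real.continuous_mul_log.comp (Channel.continuous_coe_apply a b)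
  · refine continuous_finsetSum _ fun b _ => ?_
    exact Real.continuous_mul_log.comp (continuous_finsetSum _ fun a _ =>
      continuous_const.mul (Channel.continuous_coe_apply a b))

instance (A : Finset (Fin m)) : CompactSpace (Channel X Y B A) := by
  have : IsCompact {V : SubAlph X A → SubAlph Y B → ℝ |
      ∀ a, V a ∈ stdSimplex ℝ (SubAlph Y B)} := by
    have h := isCompact_univ_pi fun _ : SubAlph X A => isCompact_stdSimplex ℝ (SubAlph Y B)
    convert h using 1
    ext V
    simp
  exact isCompact_iff_compactSpace.1 this

theorem continuous_channelDist [∀ i, Fintype (X i)] (p : (∀ i, X i) → ℝ)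
    (d : SubAlph X B → SubAlph Y B → ℝ)
    (A : Finset (Fin m)) : Continuous fun V : Channel X Y B A => channelDist p d A V := by
  refine continuous_finsetSum _ fun x _ => continuous_const.mul
    (continuous_finsetSum _ fun y _ => ?_)
  exact (Channel.continuous_coe_apply (proj A x) y).mul continuous_const

theorem continuous_ciSup_of_finite {ι : Type*} [Finite ι] [Nonempty ι] :
    Continuous fun e : ι → ℝ => ⨆ i, e i := by
  have := Fintype.ofFinite ι
  simp only [← Finset.sup'_univ_eq_ciSup]
  exact Continuous.finset_sup'_apply _ fun i _ => continuous_apply i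

end Continuity

end

end UniversalSampling

namespace UniversalSampling

open Finset Filter Topology

noncomputable section

/-! ### The coding theorem in terms of schemes -/

section Coding

variable {m k : ℕ} {X Y : Fin m → Type*} [∀ i, Fintype (X i)] [∀ i, Fintype (Y i)]
variable {Θ : Type*} {B : Finset (Fin m)}

theorem nonempty_of_pmf {p : (∀ i, X i) → ℝ} (hp1 : ∑ x, p x = 1) (i : Fin m) :
    Nonempty (X i) := by
  by_contra h
  have : IsEmpty (∀ i, X i) := ⟨fun x => h ⟨x i⟩⟩
  simp at hp1

instance [Nonempty Θ] (P : Θ → (∀ i, X i) → ℝ) : Nonempty (Atom k P) :=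
  Nonempty.map (Quotient.mk (ambiguity k P)) ‹_›

theorem atomMarginal_pos [∀ i, Nonempty (X i)] {P : Θ → (∀ i, X i) → ℝ} (hP : ∀ τ x, 0 < P τ x)
    (A : SampleSet m k) (τ₂ : Atom k P) (a : SubAlph X A.1) : 0 < atomMarginal k P A τ₂ a := by
  induction τ₂ using Quotient.inductionOn with
  | h τ => exact marginal_pos (hP τ) A.1 a

theorem sum_atomMarginal {P : Θ → (∀ i, X i) → ℝ} (hP1 : ∀ τ, ∑ x, P τ x = 1)
    (A : SampleSet m k) (τ₂ : Atom k P) : ∑ a, atomMarginal k P A τ₂ a = 1 := by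
  induction τ₂ using Quotient.inductionOn with
  | h τ => exact sum_marginal (hP1 τ) A.1

/-- Atoms are precisely what the sample laws distinguish; this is what makes the test for the atom
possible. -/
theorem atomMarginal_injective (P : Θ → (∀ i, X i) → ℝ) :
    Function.Injective fun (τ₂ : Atom k P) (z : Sample k X) => atomMarginal k P z.1 τ₂ z.2 := by
  intro τ₂ τ₂' h
  induction τ₂ using Quotient.inductionOn with
  | h τ =>
    induction τ₂' using Quotient.inductionOn with
    | h τ' => exact Quotient.sound fun A => funext fun a => congrFun h ⟨A, a⟩

theorem sum_atomMarginal_filter {P : Θ → (∀ i, X i) → ℝ} (hP1 : ∀ τ, ∑ x, P τ x = 1)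
    (τ₂ : Atom k P) (A : SampleSet m k) (_ : DecidablePred fun z : Sample k X => z.1 = A) :
    ∑ z ∈ univ.filter (fun z : Sample k X => z.1 = A), atomMarginal k P z.1 τ₂ z.2 = 1 :=
  (sum_sample_filter _ A).trans (sum_atomMarginal hP1 A τ₂)

/-- A sampling distribution together with a test channel for each atom. -/
abbrev Scheme (k : ℕ) (P : Θ → (∀ i, X i) → ℝ) (Y : Fin m → Type*) [∀ i, Fintype (Y i)]
    (B : Finset (Fin m)) := stdSimplex ℝ (SampleSet m k) × (Atom k P → SampleChannel k X Y B)

/-- The expected distortion under `τ` of the test channels `W`. -/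
def schemeDist (k : ℕ) (P : Θ → (∀ i, X i) → ℝ) (d : SubAlph X B → SubAlph Y B → ℝ)
    (PS : SampleSet m k → ℝ) (W : Atom k P → SampleChannel k X Y B) (τ : Θ) : ℝ :=
  ∑ A, PS A * channelDist (P τ) d A.1 (W (Quotient.mk _ τ) A)

/-- The largest mutual information of the test channels `W`. -/
def schemeInfo (k : ℕ) (P : Θ → (∀ i, X i) → ℝ) (PS : SampleSet m k → ℝ)
    (W : Atom k P → SampleChannel k X Y B) : ℝ :=
  ⨆ τ₂, condInfo k P PS τ₂ (W τ₂)

theorem condInfo_nonneg [∀ i, Nonempty (X i)] {P : Θ → (∀ i, X i) → ℝ} (hP : ∀ τ x, 0 < P τ x)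
    (hP1 : ∀ τ, ∑ x, P τ x = 1) {PS : SampleSet m k → ℝ} (hPS : ∀ A, 0 ≤ PS A) (τ₂ : Atom k P)
    (W : SampleChannel k X Y B) : 0 ≤ condInfo k P PS τ₂ W := by
  rw [condInfo_eq]
  exact sideInfo_nonneg hPS (fun z => atomMarginal_pos hP _ _ _)
    (fun A => sum_atomMarginal_filter hP1 τ₂ A _) (fun z y => ((W z.1).2 z.2).1 y)
    (fun z => ((W z.1).2 z.2).2)

theorem continuous_condInfo [∀ i, Nonempty (X i)] {P : Θ → (∀ i, X i) → ℝ}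
    (hP : ∀ τ x, 0 < P τ x) (τ₂ : Atom k P) :
    Continuous fun w : (SampleSet m k → ℝ) × SampleChannel k X Y B =>
      condInfo k P w.1 τ₂ w.2 := by
  refine continuous_finsetSum _ fun A _ => Continuous.mul (by fun_prop) ?_
  exact (continuous_mutualInfo (atomMarginal_pos hP A τ₂)).comp
    ((continuous_apply A).comp continuous_snd)

theorem continuous_schemeInfo [Finite Θ] [Nonempty Θ] [∀ i, Nonempty (X i)]
    {P : Θ → (∀ i, X i) → ℝ} (hP : ∀ τ x, 0 < P τ x) :
    Continuous fun w : (SampleSet m k → ℝ) × (Atom k P → SampleChannel k X Y B) =>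
      schemeInfo k P w.1 w.2 := by
  refine continuous_ciSup_of_finite.comp (continuous_pi fun τ₂ => ?_)
  exact (continuous_condInfo hP τ₂).comp
    (continuous_fst.prodMk ((continuous_apply τ₂).comp continuous_snd))

theorem continuous_schemeDist (P : Θ → (∀ i, X i) → ℝ) (d : SubAlph X B → SubAlph Y B → ℝ) :
    Continuous fun w : (SampleSet m k → ℝ) × (Atom k P → SampleChannel k X Y B) =>
      schemeDist k P d w.1 w.2 := by
  refine continuous_pi fun τ => continuous_finsetSum _ fun A _ => Continuous.mul (by fun_prop) ?_
  exact (continuous_channelDist (P τ) d A.1).comp ((continuous_apply A).comp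
    ((continuous_apply (Quotient.mk (ambiguity k P) τ)).comp continuous_snd))

theorem condInfo_le_schemeInfo [Finite Θ] {P : Θ → (∀ i, X i) → ℝ} (PS : SampleSet m k → ℝ)
    (W : Atom k P → SampleChannel k X Y B) (τ₂ : Atom k P) :
    condInfo k P PS τ₂ (W τ₂) ≤ schemeInfo k P PS W :=
  le_ciSup (f := fun τ₂ => condInfo k P PS τ₂ (W τ₂)) (Set.finite_range _).bddAbove τ₂

/-- The law of the samples is common to the whole atom, so a single averaged channel serves all its
parameters. The time-averaged sampler does not involve the atom at all, which lets the atoms share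
one sampling pmf. -/
theorem exists_sampleChannel_of_irsCode [∀ i, Nonempty (X i)] [∀ i, Nonempty (Y i)]
    {P : Θ → (∀ i, X i) → ℝ} (hP : ∀ τ x, 0 < P τ x) (hP1 : ∀ τ, ∑ x, P τ x = 1)
    (d : SubAlph X B → SubAlph Y B → ℝ) {n : ℕ} (hn : 0 < n) (c : IRSCode k X Y B n)
    (τ₂ : Atom k P) :
    ∃ W : SampleChannel k X Y B,
      (∀ τ, Quotient.mk (ambiguity k P) τ = τ₂ → c.distortion d (P τ) =
        ∑ A, (1 / (n : ℝ) * ∑ t, c.sampler t A) * channelDist (P τ) d A.1 (W A)) ∧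
      condInfo k P (fun A => 1 / (n : ℝ) * ∑ t, c.sampler t A) τ₂ W ≤ c.rate := by
  obtain ⟨W, hW, hW1, hdist, hinfo⟩ := exists_channel_of_code hn
    (π := (Sigma.fst : Sample k X → SampleSet m k)) (σ := c.sampler)
    (fun t A => (c.sampler_mem t).1 A) (fun t => (c.sampler_mem t).2)
    (p := fun z => atomMarginal k P z.1 τ₂ z.2) (fun z => atomMarginal_pos hP z.1 τ₂ z.2)
    (fun A => sum_atomMarginal_filter hP1 τ₂ A _) c.enc c.dec
  refine ⟨fun A => ⟨fun a y => W ⟨A, a⟩ y, fun a => ⟨fun y => hW _ y, hW1 _⟩⟩, fun τ hτ => ?_, ?_⟩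
  · subst hτ
    rw [distortion_eq _ (hP τ), sum_channelDist_eq (hP τ)]
    exact hdist (condDist (P τ) d)
  · rw [condInfo_eq]
    exact hinfo

/-- The converse: each code yields a scheme with the same distortions. -/
theorem exists_scheme_of_irsCode [Nonempty Θ] [∀ i, Nonempty (X i)] [∀ i, Nonempty (Y i)]
    {P : Θ → (∀ i, X i) → ℝ} (hP : ∀ τ x, 0 < P τ x) (hP1 : ∀ τ, ∑ x, P τ x = 1)
    (d : SubAlph X B → SubAlph Y B → ℝ) {n : ℕ} (hn : 0 < n) (c : IRSCode k X Y B n) :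
    ∃ w : Scheme k P Y B, (∀ τ, c.distortion d (P τ) = schemeDist k P d w.1.1 w.2 τ) ∧
      schemeInfo k P w.1.1 w.2 ≤ c.rate := by
  choose W hdist hinfo using exists_sampleChannel_of_irsCode hP hP1 d hn c
  have hn' : (0 : ℝ) < n := Nat.cast_pos.2 hn
  refine ⟨(⟨fun A => 1 / (n : ℝ) * ∑ t, c.sampler t A, fun A => ?_, ?_⟩, W), fun τ => ?_, ?_⟩
  · exact mul_nonneg (by positivity) (Finset.sum_nonneg fun t _ => (c.sampler_mem t).1 A)
  · rw [← Finset.mul_sum, Finset.sum_comm]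
    simp only [(c.sampler_mem _).2]
    simp [hn'.ne']
  · exact hdist _ τ rfl
  · exact ciSup_le hinfo

variable [Fintype Θ] [Nonempty Θ]

/-- Achievability for sampling distributions of full support. -/
theorem eventually_exists_irsCode [∀ i, Nonempty (X i)] {P : Θ → (∀ i, X i) → ℝ}
    (hP : ∀ τ x, 0 < P τ x) (hP1 : ∀ τ, ∑ x, P τ x = 1)
    {d : SubAlph X B → SubAlph Y B → ℝ} (hd : ∀ x y, 0 ≤ d x y)
    {PS : SampleSet m k → ℝ} (hPS : ∀ A, 0 < PS A) (hPS1 : ∑ A, PS A = 1)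
    (W : Atom k P → SampleChannel k X Y B) {γ : ℝ} (hγ0 : 0 < γ) (hγ : schemeInfo k P PS W < γ)
    {ε : ℝ} (hε : 0 < ε) :
    ∀ᶠ n : ℕ in atTop, ∃ c : IRSCode k X Y B n,
      c.rate < γ ∧ ∀ τ, c.distortion d (P τ) ≤ schemeDist k P d PS W τ + ε := by
  have h := eventually_exists_code (π := (Sigma.fst : Sample k X → SampleSet m k)) hPS hPS1
    (fun τ : Θ => Quotient.mk (ambiguity k P) τ)
    (p := fun τ₂ z => atomMarginal k P z.1 τ₂ z.2)
    (fun τ₂ z => atomMarginal_pos hP z.1 τ₂ z.2) (atomMarginal_injective P)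
    (fun τ₂ A => sum_atomMarginal_filter hP1 τ₂ A _)
    (W := fun τ₂ z y => (W τ₂ z.1).1 z.2 y) (fun τ₂ z y => ((W τ₂ z.1).2 z.2).1 y)
    (fun τ₂ z => ((W τ₂ z.1).2 z.2).2)
    (D := fun τ => condDist (P τ) d) (fun τ z y => condDist_nonneg (hP τ) hd z y) hγ0
    (fun τ₂ => by
      rw [← condInfo_eq]
      exact (condInfo_le_schemeInfo PS W τ₂).trans_lt hγ) hε
  filter_upwards [h] with n hn
  obtain ⟨J, f, dec, hrate, hdist⟩ := hn
  refine ⟨⟨fun _ => PS, fun _ => ⟨fun A => (hPS A).le, hPS1⟩, J, f, dec⟩, hrate, fun τ => ?_⟩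
  rw [distortion_eq _ (hP τ), schemeDist, sum_channelDist_eq (hP τ)]
  exact hdist τ

/-- Mixing in a little of the uniform pmf gives full support, and by continuity costs less than `ε`
in rate and `ε / 2` in distortion. -/
theorem eventually_exists_irsCode_of_mem_stdSimplex [∀ i, Nonempty (X i)]
    {P : Θ → (∀ i, X i) → ℝ} (hP : ∀ τ x, 0 < P τ x) (hP1 : ∀ τ, ∑ x, P τ x = 1)
    {d : SubAlph X B → SubAlph Y B → ℝ} (hd : ∀ x y, 0 ≤ d x y)
    {PS : SampleSet m k → ℝ} (hPS : PS ∈ stdSimplex ℝ (SampleSet m k))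
    (W : Atom k P → SampleChannel k X Y B) {ε : ℝ} (hε : 0 < ε) :
    ∀ᶠ n : ℕ in atTop, ∃ c : IRSCode k X Y B n, c.rate < schemeInfo k P PS W + ε ∧
      ∀ τ, c.distortion d (P τ) ≤ schemeDist k P d PS W τ + ε := by
  have hne : Nonempty (SampleSet m k) := by
    by_contra h
    rw [not_nonempty_iff] at h
    have := hPS.2
    simp at this
  have hcard : (0 : ℝ) < Fintype.card (SampleSet m k) := Nat.cast_pos.2 Fintype.card_pos
  let mix : ℝ → SampleSet m k → ℝ := fun η A =>
    (1 - η) * PS A + η * (1 / Fintype.card (SampleSet m k))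
  have hmix : Continuous mix := by
    refine continuous_pi fun A => ?_
    fun_prop
  have hmix0 : mix 0 = PS := by
    funext A; simp [mix]
  have hpair : Continuous fun η => (mix η, W) := hmix.prodMk continuous_const
  have hI : ∀ᶠ η in 𝓝 0, schemeInfo k P (mix η) W < schemeInfo k P PS W + ε := by
    have h := ((continuous_schemeInfo hP).comp hpair).tendsto 0
    simp only [Function.comp_apply, hmix0] at h
    exact h.eventually (gt_mem_nhds (lt_add_of_pos_right _ hε))
  have hE : ∀ᶠ η in 𝓝 0, ∀ τ, schemeDist k P d (mix η) W τ < schemeDist k P d PS W τ + ε / 2 := by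
    refine eventually_all.2 fun τ => ?_
    have h := ((continuous_apply τ).comp ((continuous_schemeDist P d).comp hpair)).tendsto 0
    simp only [Function.comp_apply, hmix0] at h
    exact h.eventually (gt_mem_nhds (lt_add_of_pos_right _ (half_pos hε)))
  have h01 : ∀ᶠ η : ℝ in 𝓝[>] 0, η ∈ Set.Ioo (0 : ℝ) 1 := Ioo_mem_nhdsGT one_pos
  obtain ⟨η, ⟨hη0, hη1⟩, hηI, hηE⟩ := (h01.and
    ((hI.filter_mono nhdsWithin_le_nhds).and (hE.filter_mono nhdsWithin_le_nhds))).exists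
  have hpos : ∀ A, 0 < mix η A := fun A =>
    add_pos_of_nonneg_of_pos (mul_nonneg (sub_pos.2 hη1).le (hPS.1 A)) (by positivity)
  have hsum : ∑ A, mix η A = 1 := by
    simp only [mix, Finset.sum_add_distrib, ← Finset.mul_sum, hPS.2, Finset.sum_const, card_univ,
      nsmul_eq_mul]
    field_simp
    ring
  have h0 : 0 ≤ schemeInfo k P PS W := by
    obtain ⟨τ⟩ := ‹Nonempty Θ›
    exact (condInfo_nonneg hP hP1 hPS.1 (Quotient.mk _ τ) _).trans (condInfo_le_schemeInfo PS W _)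
  filter_upwards [eventually_exists_irsCode hP hP1 hd hpos hsum W (add_pos_of_nonneg_of_pos h0 hε)
    hηI (half_pos hε)] with n ⟨c, hc, hcd⟩
  refine ⟨c, hc, fun τ => ?_⟩
  have h1 := hcd τ
  have h2 := hηE τ
  linarith

/-- The limit of the schemes that are feasible up to arbitrarily small errors. -/
theorem exists_scheme_of_forall_pos [∀ i, Nonempty (X i)] {P : Θ → (∀ i, X i) → ℝ}
    (hP : ∀ τ x, 0 < P τ x) (d : SubAlph X B → SubAlph Y B → ℝ)
    {crit : (Θ → ℝ) → ℝ} (hcrit : Continuous crit) {Δ R : ℝ}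
    (h : ∀ ε > 0, ∃ w : Scheme k P Y B, schemeInfo k P w.1.1 w.2 ≤ R + ε ∧
      crit (schemeDist k P d w.1.1 w.2) ≤ Δ + ε) :
    ∃ w : Scheme k P Y B, schemeInfo k P w.1.1 w.2 ≤ R ∧
      crit (schemeDist k P d w.1.1 w.2) ≤ Δ := by
  have hval : Continuous fun w : Scheme k P Y B => (w.1.1, w.2) := by fun_prop
  -- The larger of the two excesses attains its minimum by compactness; being at most every `ε > 0`,
  -- that minimum is at most 0.
  have hcont : Continuous fun w : Scheme k P Y B =>
      max (schemeInfo k P w.1.1 w.2 - R) (crit (schemeDist k P d w.1.1 w.2) - Δ) :=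
    (((continuous_schemeInfo hP).comp hval).sub continuous_const).max
      ((hcrit.comp ((continuous_schemeDist P d).comp hval)).sub continuous_const)
  have : CompactSpace (stdSimplex ℝ (SampleSet m k)) :=
    isCompact_iff_compactSpace.1 (isCompact_stdSimplex ℝ _)
  obtain ⟨w₁, -⟩ := h 1 one_pos
  obtain ⟨w, -, hw⟩ := (isCompact_univ (X := Scheme k P Y B)).exists_isMinOn ⟨w₁, Set.mem_univ _⟩
    hcont.continuousOn
  have hle : max (schemeInfo k P w.1.1 w.2 - R) (crit (schemeDist k P d w.1.1 w.2) - Δ) ≤ 0 := by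
    refine le_of_forall_pos_le_add fun ε hε => ?_
    obtain ⟨v, hv1, hv2⟩ := h ε hε
    refine (hw (Set.mem_univ v)).trans ?_
    rw [zero_add]
    exact max_le (by linarith) (by linarith)
  exact ⟨w, sub_nonpos.1 ((le_max_left _ _).trans hle), sub_nonpos.1 ((le_max_right _ _).trans hle)⟩

/-- The coding theorem for a general distortion criterion. -/
theorem exists_scheme_usrdf_eq [∀ i, Nonempty (X i)] [∀ i, Nonempty (Y i)]
    {P : Θ → (∀ i, X i) → ℝ} (hP : ∀ τ x, 0 < P τ x) (hP1 : ∀ τ, ∑ x, P τ x = 1)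
    {d : SubAlph X B → SubAlph Y B → ℝ} (hd : ∀ x y, 0 ≤ d x y)
    {crit : (Θ → ℝ) → ℝ} (hcrit : Continuous crit) (hmono : Monotone crit)
    (hadd : ∀ e ε, crit (fun τ => e τ + ε) ≤ crit e + ε) {Δ : ℝ}
    (hfeas : ∃ w : Scheme k P Y B, crit (schemeDist k P d w.1.1 w.2) ≤ Δ) :
    ∃ w : Scheme k P Y B, crit (schemeDist k P d w.1.1 w.2) ≤ Δ ∧
      (⨅ R ∈ {R : ℝ | Achievable k P d crit Δ R}, (R : EReal)) = schemeInfo k P w.1.1 w.2 ∧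
      ∀ v : Scheme k P Y B, crit (schemeDist k P d v.1.1 v.2) ≤ Δ →
        schemeInfo k P w.1.1 w.2 ≤ schemeInfo k P v.1.1 v.2 := by
  have hval : Continuous fun w : Scheme k P Y B => (w.1.1, w.2) := by fun_prop
  have : CompactSpace (stdSimplex ℝ (SampleSet m k)) :=
    isCompact_iff_compactSpace.1 (isCompact_stdSimplex ℝ _)
  have hclosed : IsClosed {w : Scheme k P Y B | crit (schemeDist k P d w.1.1 w.2) ≤ Δ} :=
    isClosed_le (hcrit.comp ((continuous_schemeDist P d).comp hval)) continuous_const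
  obtain ⟨w, hw, hmin⟩ := hclosed.isCompact.exists_isMinOn hfeas
    ((continuous_schemeInfo hP).comp hval).continuousOn
  have hmin' : ∀ v : Scheme k P Y B, crit (schemeDist k P d v.1.1 v.2) ≤ Δ →
      schemeInfo k P w.1.1 w.2 ≤ schemeInfo k P v.1.1 v.2 := fun v hv => hmin hv
  refine ⟨w, hw, le_antisymm ?_ ?_, hmin'⟩
  · refine iInf₂_le _ ⟨?_, fun ε hε => ?_⟩
    · obtain ⟨τ⟩ := ‹Nonempty Θ›
      exact (condInfo_nonneg hP hP1 w.1.2.1 (Quotient.mk _ τ) _).trans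
        (condInfo_le_schemeInfo w.1.1 w.2 _)
    · filter_upwards [eventually_exists_irsCode_of_mem_stdSimplex hP hP1 hd w.1.2 w.2 hε]
        with n ⟨c, hc, hcd⟩
      have hw' : crit (schemeDist k P d w.1.1 w.2) ≤ Δ := hw
      refine ⟨c, hc, (hmono fun τ => hcd τ).trans ((hadd _ _).trans ?_)⟩
      linarith
  · refine le_iInf₂ fun R hR => EReal.coe_le_coe_iff.2 ?_
    obtain ⟨v, hv1, hv2⟩ := exists_scheme_of_forall_pos (k := k) (Y := Y) hP d hcrit (Δ := Δ)
      (R := R) (by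
        intro ε hε
        -- One code of positive length per `ε` is enough for the converse.
        obtain ⟨n, ⟨c, hc, hcd⟩, hn⟩ := ((hR.2 ε hε).and (eventually_gt_atTop 0)).exists
        obtain ⟨v, hvd, hvi⟩ := exists_scheme_of_irsCode hP hP1 d hn c
        exact ⟨v, hvi.trans hc.le, by rwa [← funext hvd]⟩)
    exact (hmin' v hv2).trans hv1

end Coding

end

end UniversalSampling

namespace UniversalSampling

open Finset Filter Topology

noncomputable section

/-! ### Single-letter formulas and feasibility -/

section SingleLetter

variable {m k : ℕ} {X Y : Fin m → Type*} [∀ i, Fintype (X i)] {Θ : Type*} {B : Finset (Fin m)}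

theorem mem_atomSet [Fintype Θ] {P : Θ → (∀ i, X i) → ℝ} {τ₂ : Atom k P} {τ : Θ} :
    τ ∈ atomSet k P τ₂ ↔ Quotient.mk (ambiguity k P) τ = τ₂ := by
  simp [atomSet]

theorem sum_atomSet [Fintype Θ] (P : Θ → (∀ i, X i) → ℝ) (F : Θ → ℝ) :
    ∑ τ₂ : Atom k P, ∑ τ ∈ atomSet k P τ₂, F τ = ∑ τ, F τ := by
  classical
  rw [← Finset.sum_fiberwise univ (fun τ => Quotient.mk (ambiguity k P) τ) F]
  refine Finset.sum_congr rfl fun τ₂ _ => Finset.sum_congr ?_ fun _ _ => rfl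
  ext τ
  simp [mem_atomSet]

theorem atomPmf_pos [Fintype Θ] {P : Θ → (∀ i, X i) → ℝ} {μ : Θ → ℝ} (hμ : ∀ τ, 0 < μ τ)
    (τ₂ : Atom k P) : 0 < atomPmf k P μ τ₂ := by
  induction τ₂ using Quotient.inductionOn with
  | h τ => exact Finset.sum_pos (fun τ _ => hμ τ) ⟨τ, mem_atomSet.2 rfl⟩

/-- Equal marginals within the atom make the denominator of `atomDist` a product; clearing it leaves
an expression linear in the parameters. -/
theorem atomPmf_mul_atomDist [Fintype Θ] [∀ i, Nonempty (X i)] {P : Θ → (∀ i, X i) → ℝ}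
    (hP : ∀ τ x, 0 < P τ x) {μ : Θ → ℝ} (hμ : ∀ τ, 0 < μ τ) (d : SubAlph X B → SubAlph Y B → ℝ)
    (A : SampleSet m k) (τ₂ : Atom k P) (a : SubAlph X A.1) (y : SubAlph Y B) :
    atomPmf k P μ τ₂ * (atomMarginal k P A τ₂ a * atomDist k P μ d A τ₂ a y) =
      ∑ τ ∈ atomSet k P τ₂,
        μ τ * (marginal (P τ) A.1 a * condDist (P τ) d (⟨A, a⟩ : Sample k X) y) := by
  have hden : ∑ τ ∈ atomSet k P τ₂, μ τ * marginal (P τ) A.1 a =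
      atomPmf k P μ τ₂ * atomMarginal k P A τ₂ a := by
    rw [atomPmf, Finset.sum_mul]
    refine Finset.sum_congr rfl fun τ hτ => ?_
    rw [← mem_atomSet.1 hτ]
    rfl
  have hpos : 0 < atomPmf k P μ τ₂ * atomMarginal k P A τ₂ a :=
    mul_pos (atomPmf_pos hμ τ₂) (atomMarginal_pos hP A τ₂ a)
  rw [← mul_assoc, atomDist, hden, mul_div_cancel₀ _ hpos.ne']
  exact Finset.sum_congr rfl fun τ _ => congrArg (μ τ * ·)
    (marginal_mul_condDist (hP τ) d (⟨A, a⟩ : Sample k X) y).symm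

variable [∀ i, Fintype (Y i)]

/-- The mutual information attains its minimum on a nonempty closed set of test channels. -/
theorem exists_condInfo_eq_iInf [∀ i, Nonempty (X i)] {P : Θ → (∀ i, X i) → ℝ}
    (hP : ∀ τ x, 0 < P τ x) (PS : SampleSet m k → ℝ) (τ₂ : Atom k P)
    {κ : Set (SampleChannel k X Y B)} (hκ : IsClosed κ) (hne : κ.Nonempty) :
    ∃ W ∈ κ, (condInfo k P PS τ₂ W : EReal) = ⨅ W ∈ κ, (condInfo k P PS τ₂ W : EReal) := by
  have hc : Continuous fun W : SampleChannel k X Y B => condInfo k P PS τ₂ W :=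
    (continuous_condInfo hP τ₂).comp (continuous_const.prodMk continuous_id)
  obtain ⟨W, hW, hmin⟩ := hκ.isCompact.exists_isMinOn hne hc.continuousOn
  exact ⟨W, hW, le_antisymm (le_iInf₂ fun V hV => EReal.coe_le_coe_iff.2 (hmin hV))
    (iInf₂_le W hW)⟩

theorem coe_schemeInfo [Finite Θ] [Nonempty Θ] {P : Θ → (∀ i, X i) → ℝ}
    (PS : SampleSet m k → ℝ) (W : Atom k P → SampleChannel k X Y B) :
    (schemeInfo k P PS W : EReal) = ⨆ τ₂, (condInfo k P PS τ₂ (W τ₂) : EReal) := by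
  refine le_antisymm ?_ (iSup_le fun τ₂ => EReal.coe_le_coe_iff.2 (condInfo_le_schemeInfo PS W τ₂))
  obtain ⟨τ₂, h⟩ := exists_eq_ciSup_of_finite (f := fun τ₂ => condInfo k P PS τ₂ (W τ₂))
  rw [schemeInfo, ← h]
  exact le_iSup (fun τ₂ => (condInfo k P PS τ₂ (W τ₂) : EReal)) τ₂

/-- Given, for each atom, a set of test channels, the largest of the least mutual informations is
attained by a choice of test channels. -/
theorem exists_schemeInfo_le_iSup [Finite Θ] [Nonempty Θ] {P : Θ → (∀ i, X i) → ℝ}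
    {PS : SampleSet m k → ℝ} {κ : Atom k P → Set (SampleChannel k X Y B)}
    (hκ : ∀ τ₂, (κ τ₂).Nonempty → ∃ W ∈ κ τ₂,
      (condInfo k P PS τ₂ W : EReal) = ⨅ W ∈ κ τ₂, (condInfo k P PS τ₂ W : EReal))
    (hfin : ⨆ τ₂, ⨅ W ∈ κ τ₂, (condInfo k P PS τ₂ W : EReal) ≠ ⊤) :
    ∃ W : Atom k P → SampleChannel k X Y B, (∀ τ₂, W τ₂ ∈ κ τ₂) ∧
      (schemeInfo k P PS W : EReal) = ⨆ τ₂, ⨅ W ∈ κ τ₂, (condInfo k P PS τ₂ W : EReal) := by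
  -- An empty constraint set has infimum `⊤`, contrary to `hfin`.
  have hne : ∀ τ₂, (κ τ₂).Nonempty := by
    intro τ₂
    by_contra h
    rw [Set.not_nonempty_iff_eq_empty] at h
    refine hfin (top_le_iff.1 (le_trans ?_
      (le_iSup (fun τ₂ => ⨅ W ∈ κ τ₂, (condInfo k P PS τ₂ W : EReal)) τ₂)))
    simp [h]
  choose W hW hmin using fun τ₂ => hκ τ₂ (hne τ₂)
  exact ⟨W, hW, by rw [coe_schemeInfo]; exact iSup_congr hmin⟩

section Bayes

variable [Fintype Θ]

/-- `E[d_{τ₂}(X_S, Y_B) | θ₂ = τ₂]`. -/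
def bayesDist (k : ℕ) (P : Θ → (∀ i, X i) → ℝ) (μ : Θ → ℝ) (d : SubAlph X B → SubAlph Y B → ℝ)
    (PS : SampleSet m k → ℝ) (τ₂ : Atom k P) (W : SampleChannel k X Y B) : ℝ :=
  ∑ A, PS A * ∑ a, atomMarginal k P A τ₂ a * ∑ y, (W A).1 a y * atomDist k P μ d A τ₂ a y

theorem continuous_bayesDist (P : Θ → (∀ i, X i) → ℝ) (μ : Θ → ℝ)
    (d : SubAlph X B → SubAlph Y B → ℝ) (PS : SampleSet m k → ℝ) (τ₂ : Atom k P) :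
    Continuous fun W : SampleChannel k X Y B => bayesDist k P μ d PS τ₂ W := by
  refine continuous_finsetSum _ fun A _ => continuous_const.mul (continuous_finsetSum _ fun a _ =>
    continuous_const.mul (continuous_finsetSum _ fun y _ => Continuous.mul ?_ continuous_const))
  exact (Channel.continuous_coe_apply a y).comp (continuous_apply A)

/-- The expected distortion is the average over the atoms of the distortions given the atom. -/
theorem sum_mul_schemeDist [∀ i, Nonempty (X i)] {P : Θ → (∀ i, X i) → ℝ}
    (hP : ∀ τ x, 0 < P τ x) {μ : Θ → ℝ} (hμ : ∀ τ, 0 < μ τ) (d : SubAlph X B → SubAlph Y B → ℝ)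
    (PS : SampleSet m k → ℝ) (W : Atom k P → SampleChannel k X Y B) :
    ∑ τ, μ τ * schemeDist k P d PS W τ =
      ∑ τ₂, atomPmf k P μ τ₂ * bayesDist k P μ d PS τ₂ (W τ₂) := by
  rw [← sum_atomSet P]
  refine Finset.sum_congr rfl fun τ₂ _ => ?_
  symm
  calc atomPmf k P μ τ₂ * bayesDist k P μ d PS τ₂ (W τ₂)
      = ∑ A, PS A * ∑ a, ∑ y, (W τ₂ A).1 a y *
          (atomPmf k P μ τ₂ * (atomMarginal k P A τ₂ a * atomDist k P μ d A τ₂ a y)) := by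
        simp only [bayesDist, Finset.mul_sum]
        refine Finset.sum_congr rfl fun A _ => Finset.sum_congr rfl fun a _ =>
          Finset.sum_congr rfl fun y _ => ?_
        ring
    _ = ∑ A, ∑ a, ∑ y, ∑ τ ∈ atomSet k P τ₂, μ τ * (PS A * (marginal (P τ) A.1 a *
          ((W τ₂ A).1 a y * condDist (P τ) d (⟨A, a⟩ : Sample k X) y))) := by
        simp only [atomPmf_mul_atomDist hP hμ, Finset.mul_sum]
        refine Finset.sum_congr rfl fun A _ => Finset.sum_congr rfl fun a _ =>
          Finset.sum_congr rfl fun y _ => Finset.sum_congr rfl fun τ _ => ?_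
        ring
    _ = ∑ A, ∑ a, ∑ τ ∈ atomSet k P τ₂, ∑ y, μ τ * (PS A * (marginal (P τ) A.1 a *
          ((W τ₂ A).1 a y * condDist (P τ) d (⟨A, a⟩ : Sample k X) y))) :=
        Finset.sum_congr rfl fun A _ => Finset.sum_congr rfl fun a _ => Finset.sum_comm
    _ = ∑ A, ∑ τ ∈ atomSet k P τ₂, ∑ a, ∑ y, μ τ * (PS A * (marginal (P τ) A.1 a *
          ((W τ₂ A).1 a y * condDist (P τ) d (⟨A, a⟩ : Sample k X) y))) :=
        Finset.sum_congr rfl fun A _ => Finset.sum_comm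
    _ = ∑ τ ∈ atomSet k P τ₂, ∑ A, ∑ a, ∑ y, μ τ * (PS A * (marginal (P τ) A.1 a *
          ((W τ₂ A).1 a y * condDist (P τ) d (⟨A, a⟩ : Sample k X) y))) := Finset.sum_comm
    _ = ∑ τ ∈ atomSet k P τ₂, μ τ * schemeDist k P d PS W τ := by
        refine Finset.sum_congr rfl fun τ hτ => ?_
        simp only [schemeDist, channelDist_eq (hP τ), mem_atomSet.1 hτ, Finset.mul_sum]

/-- Always sampling the best set and reproducing, for each atom and observation, the best letter
attains `deltaMinBayes` exactly. -/
theorem exists_scheme_bayes_le (hkm : k ≤ m) [∀ i, Nonempty (X i)] [∀ i, Nonempty (Y i)]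
    {P : Θ → (∀ i, X i) → ℝ} (hP : ∀ τ x, 0 < P τ x) {μ : Θ → ℝ} (hμ : ∀ τ, 0 < μ τ)
    (d : SubAlph X B → SubAlph Y B → ℝ) {Δ : ℝ} (hΔ : deltaMinBayes k P μ d ≤ Δ) :
    ∃ w : Scheme k P Y B, ∑ τ, μ τ * schemeDist k P d w.1.1 w.2 τ ≤ Δ := by
  classical
  have hne : Nonempty (SampleSet m k) := by
    obtain ⟨A, -, hA⟩ := Finset.exists_subset_card_eq (s := (univ : Finset (Fin m))) (n := k)
      (by simpa using hkm)
    exact ⟨⟨A, hA⟩⟩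
  obtain ⟨A₀, hA₀⟩ := exists_eq_ciInf_of_finite (f := fun A : SampleSet m k =>
    ∑ τ₂, atomPmf k P μ τ₂ * ∑ a, atomMarginal k P A τ₂ a * ⨅ y, atomDist k P μ d A τ₂ a y)
  choose y hy using fun (τ₂ : Atom k P) (A : SampleSet m k) (a : SubAlph X A.1) =>
    exists_eq_ciInf_of_finite (f := fun y => atomDist k P μ d A τ₂ a y)
  refine ⟨(⟨Pi.single A₀ 1, single_mem_stdSimplex ℝ A₀⟩, fun τ₂ A =>
    ⟨fun a => Pi.single (y τ₂ A a) 1, fun a => single_mem_stdSimplex ℝ _⟩), ?_⟩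
  rw [sum_mul_schemeDist hP hμ]
  refine le_trans (le_of_eq ?_) hΔ
  rw [deltaMinBayes, ← hA₀]
  refine Finset.sum_congr rfl fun τ₂ _ => ?_
  congr 1
  rw [bayesDist, Finset.sum_eq_single A₀]
  · simp only [Pi.single_eq_same, one_mul]
    refine Finset.sum_congr rfl fun a _ => ?_
    rw [← hy, Finset.sum_eq_single (y τ₂ A₀ a)]
    · simp
    · intro b _ hb; simp [Pi.single_eq_of_ne hb]
    · simp
  · intro A _ hA; simp [Pi.single_eq_of_ne hA]
  · simp

end Bayes

section NonBayes

variable [Fintype Θ]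

theorem isClosed_kappaNonBayes (P : Θ → (∀ i, X i) → ℝ) (d : SubAlph X B → SubAlph Y B → ℝ)
    (δ : ℝ) (PS : SampleSet m k → ℝ) (τ₂ : Atom k P) :
    IsClosed (kappaNonBayes k P d δ PS τ₂) := by
  simp only [kappaNonBayes, Set.ofPred_forall]
  refine isClosed_iInter fun τ => isClosed_iInter fun _ => isClosed_le ?_ continuous_const
  exact continuous_finsetSum _ fun A _ => continuous_const.mul
    ((continuous_channelDist (P τ) d A.1).comp (continuous_apply A))

theorem iSup_schemeDist_le_iff [Nonempty Θ] {P : Θ → (∀ i, X i) → ℝ}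
    {d : SubAlph X B → SubAlph Y B → ℝ} {δ : ℝ} {PS : SampleSet m k → ℝ}
    {W : Atom k P → SampleChannel k X Y B} :
    ⨆ τ, schemeDist k P d PS W τ ≤ δ ↔ ∀ τ₂, W τ₂ ∈ kappaNonBayes k P d δ PS τ₂ := by
  rw [ciSup_le_iff (Set.finite_range _).bddAbove]
  constructor
  · rintro h τ₂ τ hτ
    obtain rfl := mem_atomSet.1 hτ
    exact h τ
  · intro h τ
    exact h (Quotient.mk _ τ) τ (mem_atomSet.2 rfl)

/-- Near-optimal choices, with `ε / 2` lost on the sampling pmf and `ε / 2` on the channels, bound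
the distortion of each parameter by the sum of the per-set maxima. Compactness removes `ε`. -/
theorem exists_scheme_nonBayes_le (hkm : k ≤ m) [Nonempty Θ]
    [∀ i, Nonempty (Y i)] (P : Θ → (∀ i, X i) → ℝ)
    (d : SubAlph X B → SubAlph Y B → ℝ) {Δ : ℝ} (hΔ : deltaMinNonBayes k P d ≤ Δ) :
    ∃ w : Scheme k P Y B, ⨆ τ, schemeDist k P d w.1.1 w.2 τ ≤ Δ := by
  classical
  have hne : Nonempty (SampleSet m k) := by
    obtain ⟨A, -, hA⟩ := Finset.exists_subset_card_eq (s := (univ : Finset (Fin m))) (n := k)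
      (by simpa using hkm)
    exact ⟨⟨A, hA⟩⟩
  have hneV : ∀ A : SampleSet m k, Nonempty (Channel X Y B A.1) := fun A =>
    ⟨⟨fun _ => Pi.single (Classical.arbitrary _) 1, fun _ => single_mem_stdSimplex ℝ _⟩⟩
  have : Nonempty (stdSimplex ℝ (SampleSet m k)) :=
    ⟨⟨Pi.single (Classical.arbitrary _) 1, single_mem_stdSimplex ℝ _⟩⟩
  have key : ∀ ε > 0, ∃ w : Scheme k P Y B, ⨆ τ, schemeDist k P d w.1.1 w.2 τ ≤ Δ + ε := by
    intro ε hε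
    obtain ⟨PS, hPS⟩ := exists_lt_of_ciInf_lt (hΔ.trans_lt (lt_add_of_pos_right Δ (half_pos hε)))
    choose V hV using fun (τ₂ : Atom k P) (A : SampleSet m k) => exists_lt_of_ciInf_lt
      (lt_add_of_pos_right (⨅ V : Channel X Y B A.1, ⨆ τ : atomSet k P τ₂,
        channelDist (P τ) d A.1 V) (half_pos hε))
    refine ⟨(PS, V), iSup_schemeDist_le_iff.2 fun τ₂ τ hτ => ?_⟩
    have h1 : ∑ A : SampleSet m k, PS.1 A * ⨅ V : Channel X Y B A.1, ⨆ τ : atomSet k P τ₂,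
        channelDist (P τ) d A.1 V < Δ + ε / 2 :=
      (le_ciSup (f := fun τ₂ : Atom k P => ∑ A : SampleSet m k, PS.1 A *
        ⨅ V : Channel X Y B A.1, ⨆ τ : atomSet k P τ₂, channelDist (P τ) d A.1 V)
        (Set.finite_range _).bddAbove τ₂).trans_lt hPS
    calc ∑ A, PS.1 A * channelDist (P τ) d A.1 (V τ₂ A)
        ≤ ∑ A : SampleSet m k, PS.1 A * ((⨅ V : Channel X Y B A.1, ⨆ τ : atomSet k P τ₂,
            channelDist (P τ) d A.1 V) + ε / 2) := by
          refine Finset.sum_le_sum fun A _ => mul_le_mul_of_nonneg_left ?_ (PS.2.1 A)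
          exact (le_ciSup (f := fun τ : atomSet k P τ₂ => channelDist (P τ) d A.1 (V τ₂ A))
            (Set.finite_range _).bddAbove ⟨τ, hτ⟩).trans (hV τ₂ A).le
      _ ≤ Δ + ε := by
          simp only [mul_add, Finset.sum_add_distrib, ← Finset.sum_mul, PS.2.2]
          linarith
  obtain ⟨w₁, -⟩ := key 1 one_pos
  have hval : Continuous fun w : Scheme k P Y B => (w.1.1, w.2) := by fun_prop
  have hcont : Continuous fun w : Scheme k P Y B => ⨆ τ, schemeDist k P d w.1.1 w.2 τ :=
    continuous_ciSup_of_finite.comp ((continuous_schemeDist P d).comp hval)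
  have : CompactSpace (stdSimplex ℝ (SampleSet m k)) :=
    isCompact_iff_compactSpace.1 (isCompact_stdSimplex ℝ _)
  obtain ⟨w, -, hw⟩ := (isCompact_univ (X := Scheme k P Y B)).exists_isMinOn ⟨w₁, Set.mem_univ _⟩
    hcont.continuousOn
  refine ⟨w, le_of_forall_pos_le_add fun ε hε => ?_⟩
  obtain ⟨v, hv⟩ := key ε hε
  exact (hw (Set.mem_univ v)).trans hv

end NonBayes

end SingleLetter

/-! ### The two settings -/

section MainResults

variable {m k : ℕ} {X Y : Fin m → Type*} [∀ i, Fintype (X i)] [∀ i, Fintype (Y i)]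
  [∀ i, Nonempty (X i)] {Θ : Type*} [Fintype Θ]
  {P : Θ → (∀ i, X i) → ℝ} {B : Finset (Fin m)} {d : SubAlph X B → SubAlph Y B → ℝ}

theorem exists_condInfo_eq_rhoBayes (hP : ∀ τ x, 0 < P τ x) (μ : Θ → ℝ)
    (d : SubAlph X B → SubAlph Y B → ℝ) (δ : ℝ) (PS : SampleSet m k → ℝ) (τ₂ : Atom k P)
    (hne : (kappaBayes k P μ d δ PS τ₂).Nonempty) :
    ∃ W ∈ kappaBayes k P μ d δ PS τ₂,
      (condInfo k P PS τ₂ W : EReal) = rhoBayes k P μ d δ PS τ₂ :=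
  exists_condInfo_eq_iInf hP PS τ₂
    (isClosed_le (continuous_bayesDist P μ d PS τ₂) continuous_const) hne

theorem exists_condInfo_eq_rhoNonBayes (hP : ∀ τ x, 0 < P τ x)
    (d : SubAlph X B → SubAlph Y B → ℝ) (δ : ℝ) (PS : SampleSet m k → ℝ) (τ₂ : Atom k P)
    (hne : (kappaNonBayes k P d δ PS τ₂).Nonempty) :
    ∃ W ∈ kappaNonBayes k P d δ PS τ₂,
      (condInfo k P PS τ₂ W : EReal) = rhoNonBayes k P d δ PS τ₂ :=
  exists_condInfo_eq_iInf hP PS τ₂ (isClosed_kappaNonBayes P d δ PS τ₂) hne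

variable [Nonempty Θ] [∀ i, Nonempty (Y i)]

/-- The average distortion splits over atoms. For given levels `D`, minimizing separately in each
atom yields an admissible scheme; conversely the optimal scheme is recovered by taking its own atom
distortions as levels. -/
theorem usrdfBayes_isLeast (hkm : k ≤ m) (hP : ∀ τ x, 0 < P τ x) (hP1 : ∀ τ, ∑ x, P τ x = 1)
    (hd : ∀ x y, 0 ≤ d x y) {μ : Θ → ℝ} (hμ : ∀ τ, 0 < μ τ) (hμ1 : ∑ τ, μ τ = 1)
    {Δ : ℝ} (hΔ : deltaMinBayes k P μ d ≤ Δ) :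
    usrdfBayes k P μ d Δ ≠ ⊤ ∧
      IsLeast {r : EReal | ∃ PS ∈ stdSimplex ℝ (SampleSet m k), ∃ D : Atom k P → ℝ,
          ∑ τ₂, atomPmf k P μ τ₂ * D τ₂ ≤ Δ ∧ r = ⨆ τ₂, rhoBayes k P μ d (D τ₂) PS τ₂}
        (usrdfBayes k P μ d Δ) := by
  obtain ⟨w, hw, heq, hmin⟩ := exists_scheme_usrdf_eq hP hP1 hd
    (crit := fun e => ∑ τ, μ τ * e τ) (by fun_prop)
    (fun e e' h => Finset.sum_le_sum fun τ _ => mul_le_mul_of_nonneg_left (h τ) (hμ τ).le)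
    (fun e ε => by simp only [mul_add, Finset.sum_add_distrib, ← Finset.sum_mul, hμ1, one_mul,
      le_refl])
    (exists_scheme_bayes_le hkm hP hμ d hΔ)
  have husr : usrdfBayes k P μ d Δ = schemeInfo k P w.1.1 w.2 := heq
  have hlow : ∀ PS ∈ stdSimplex ℝ (SampleSet m k), ∀ D : Atom k P → ℝ,
      ∑ τ₂, atomPmf k P μ τ₂ * D τ₂ ≤ Δ →
      (schemeInfo k P w.1.1 w.2 : EReal) ≤ ⨆ τ₂, rhoBayes k P μ d (D τ₂) PS τ₂ := by
    intro PS hPS D hD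
    by_cases hfin : ⨆ τ₂, rhoBayes k P μ d (D τ₂) PS τ₂ = ⊤
    · rw [hfin]; exact le_top
    obtain ⟨W, hW, hWeq⟩ := exists_schemeInfo_le_iSup
      (fun τ₂ => exists_condInfo_eq_rhoBayes hP μ d (D τ₂) PS τ₂) hfin
    refine le_trans (EReal.coe_le_coe_iff.2 (hmin (⟨PS, hPS⟩, W) ?_)) hWeq.le
    dsimp only
    rw [sum_mul_schemeDist hP hμ]
    exact (Finset.sum_le_sum fun τ₂ _ =>
      mul_le_mul_of_nonneg_left (hW τ₂) (atomPmf_pos hμ τ₂).le).trans hD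
  rw [husr]
  refine ⟨EReal.coe_ne_top _, ⟨w.1.1, w.1.2, fun τ₂ => bayesDist k P μ d w.1.1 τ₂ (w.2 τ₂), ?_, ?_⟩,
    ?_⟩
  · rw [← sum_mul_schemeDist hP hμ]
    exact hw
  · refine le_antisymm (hlow _ w.1.2 _ ?_) ?_
    · rw [← sum_mul_schemeDist hP hμ]
      exact hw
    · rw [coe_schemeInfo]
      exact iSup_mono fun τ₂ => iInf₂_le (w.2 τ₂) (le_refl (bayesDist k P μ d w.1.1 τ₂ (w.2 τ₂)))
  · rintro r ⟨PS, hPS, D, hD, rfl⟩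
    exact hlow PS hPS D hD

/-- The peak criterion is a conjunction of constraints, one for each atom, so the same level `Δ`
applies to all and nothing is split. -/
theorem usrdfNonBayes_isLeast (hkm : k ≤ m) (hP : ∀ τ x, 0 < P τ x) (hP1 : ∀ τ, ∑ x, P τ x = 1)
    (hd : ∀ x y, 0 ≤ d x y) {Δ : ℝ} (hΔ : deltaMinNonBayes k P d ≤ Δ) :
    usrdfNonBayes k P d Δ ≠ ⊤ ∧
      IsLeast {r : EReal | ∃ PS ∈ stdSimplex ℝ (SampleSet m k),
          r = ⨆ τ₂, rhoNonBayes k P d Δ PS τ₂}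
        (usrdfNonBayes k P d Δ) := by
  obtain ⟨w, hw, heq, hmin⟩ := exists_scheme_usrdf_eq hP hP1 hd
    (crit := fun e => ⨆ τ, e τ) continuous_ciSup_of_finite
    (fun e e' h => ciSup_mono (Set.finite_range _).bddAbove h)
    (fun e ε => ciSup_le fun τ => add_le_add_left (le_ciSup (Set.finite_range e).bddAbove τ) ε)
    (exists_scheme_nonBayes_le hkm P d hΔ)
  have husr : usrdfNonBayes k P d Δ = schemeInfo k P w.1.1 w.2 := heq
  have hlow : ∀ PS ∈ stdSimplex ℝ (SampleSet m k),
      (schemeInfo k P w.1.1 w.2 : EReal) ≤ ⨆ τ₂, rhoNonBayes k P d Δ PS τ₂ := by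
    intro PS hPS
    by_cases hfin : ⨆ τ₂, rhoNonBayes k P d Δ PS τ₂ = ⊤
    · rw [hfin]; exact le_top
    obtain ⟨W, hW, hWeq⟩ := exists_schemeInfo_le_iSup
      (fun τ₂ => exists_condInfo_eq_rhoNonBayes hP d Δ PS τ₂) hfin
    exact le_trans (EReal.coe_le_coe_iff.2 (hmin (⟨PS, hPS⟩, W) (iSup_schemeDist_le_iff.2 hW)))
      hWeq.le
  rw [husr]
  refine ⟨EReal.coe_ne_top _, ⟨w.1.1, w.1.2, le_antisymm (hlow _ w.1.2) ?_⟩, ?_⟩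
  · rw [coe_schemeInfo]
    exact iSup_mono fun τ₂ => iInf₂_le (w.2 τ₂) (iSup_schemeDist_le_iff.1 hw τ₂)
  · rintro r ⟨PS, hPS, rfl⟩
    exact hlow PS hPS

end MainResults

end

end UniversalSampling
open UniversalSampling in
theorem theorem2 {m k : ℕ} (hk : 1 ≤ k) (hkm : k ≤ m)
    {X Y : Fin m → Type*} [∀ i, Fintype (X i)] [∀ i, Fintype (Y i)] [∀ i, Nonempty (Y i)]
    {Θ : Type*} [Fintype Θ] [Nonempty Θ]
    (P : Θ → (∀ i, X i) → ℝ) (hP : ∀ τ x, 0 < P τ x) (hP_sum : ∀ τ, ∑ x, P τ x = 1)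
    (B : Finset (Fin m)) (hB : B.Nonempty)
    (d : SubAlph X B → SubAlph Y B → ℝ) (hd : ∀ x y, 0 ≤ d x y) :
    -- Bayesian setting
    (∀ μ : Θ → ℝ, (∀ τ, 0 < μ τ) → ∑ τ, μ τ = 1 →
      (∀ (δ : ℝ), ∀ PS ∈ stdSimplex ℝ (SampleSet m k), ∀ τ₂ : Atom k P,
        (kappaBayes k P μ d δ PS τ₂).Nonempty →
          ∃ W ∈ kappaBayes k P μ d δ PS τ₂,
            (condInfo k P PS τ₂ W : EReal) = rhoBayes k P μ d δ PS τ₂) ∧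
      ∀ Δ : ℝ, deltaMinBayes k P μ d ≤ Δ → Δ ≤ deltaMaxBayes k P μ d →
        usrdfBayes k P μ d Δ ≠ ⊤ ∧
        IsLeast {r : EReal | ∃ PS ∈ stdSimplex ℝ (SampleSet m k), ∃ D : Atom k P → ℝ,
            ∑ τ₂, atomPmf k P μ τ₂ * D τ₂ ≤ Δ ∧
            r = ⨆ τ₂, rhoBayes k P μ d (D τ₂) PS τ₂}
          (usrdfBayes k P μ d Δ)) ∧
    -- nonBayesian setting
    ((∀ (δ : ℝ), ∀ PS ∈ stdSimplex ℝ (SampleSet m k), ∀ τ₂ : Atom k P,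
        (kappaNonBayes k P d δ PS τ₂).Nonempty →
          ∃ W ∈ kappaNonBayes k P d δ PS τ₂,
            (condInfo k P PS τ₂ W : EReal) = rhoNonBayes k P d δ PS τ₂) ∧
      ∀ Δ : ℝ, deltaMinNonBayes k P d ≤ Δ → Δ ≤ deltaMaxNonBayes k P d →
        usrdfNonBayes k P d Δ ≠ ⊤ ∧
        IsLeast {r : EReal | ∃ PS ∈ stdSimplex ℝ (SampleSet m k),
            r = ⨆ τ₂, rhoNonBayes k P d Δ PS τ₂}
          (usrdfNonBayes k P d Δ)) := by
  -- A pmf of total mass 1 cannot live on an empty product.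
  have hX : ∀ i, Nonempty (X i) := nonempty_of_pmf (hP_sum (Classical.arbitrary Θ))
  refine ⟨fun μ hμ hμ_sum => ⟨fun δ PS _ τ₂ => exists_condInfo_eq_rhoBayes hP μ d δ PS τ₂,
    fun Δ hΔ _ => usrdfBayes_isLeast hkm hP hP_sum hd hμ hμ_sum hΔ⟩,
    fun δ PS _ τ₂ => exists_condInfo_eq_rhoNonBayes hP d δ PS τ₂,
    fun Δ hΔ _ => usrdfNonBayes_isLeast hkm hP hP_sum hd hΔ⟩
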